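/- \textbf{Model.} Fix densities $\lambda_P,\lambda_S>0$, a path-loss exponent $\alpha>2$, a transmission power $P_t>0$, a guard zone radius $r_g\ge 0$, thresholds $\beta_P,\beta_S>0$, noise powers $\sigma_P^2,\sigma_S^2\ge 0$, and a point $x_1\in\mathbb R^2$ with $r_1=\|x_1\|>0$. The typical primary receiver (PR) is at the origin and the typical primary transmitter (PT) is at $x_1$. The energy receivers (ERs, the eavesdroppers) form a homogeneous Poisson point process $\Phi_S=\{y_j\}$ on $\mathbb R^2$ of density $\lambda_S$. Let $R_e$ be the distance from $x_1$ to the nearest ER, and $P_{\rm active}=\mathbb P(R_e\ge r_g)$. The correlations between the activities of different PTs, and between the interferences at different receivers, are ignored. That is, each receiver $k$ (the PR, or an ER $y_j$) has its own independent copy $\{x_{k,i}\}_i$ of the homogeneous Poisson process of interfering PTs, of density $\lambda_P$. Each interfering PT carries a $\{0,1\}$-valued mark with mean $P_{\rm active}$. Put $\delta_{k,i}=1$ if the PT at $x_{k,i}$ has mark $1$ and, when the receiver $k$ is an ER $y_j$, also $\|x_{k,i}-y_j\|\ge r_g$ (a PT closer than $r_g$ to an ER is silent); otherwise $\delta_{k,i}=0$.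 The fading gains $h_k$ (from the typical PT to receiver $k$) and $g_{k,i}$ (from $x_{k,i}$ to receiver $k$) are exponential with mean $1$. The process $\Phi_S$, the Poisson processes of PTs, all marks and all fading gains are mutually independent. For receiver $k$ at location $z_k$, with noise power $\sigma_k^2$ ($\sigma_P^2$ for the PR, $\sigma_S^2$ for an ER), let $$\mathrm{SINR}_k=\frac{P_t h_k\|x_1-z_k\|^{-\alpha}}{\sum_i\delta_{k,i}P_t g_{k,i}\|x_{k,i}-z_k\|^{-\alpha}+\sigma_k^2}.$$ Write $\mathrm{SINR}_P$ for the value at the PR and $\mathrm{SINR}_S(y_j)$ for the value at the ER $y_j$, and define $$P_{\rm con}=\mathbb P(R_e\ge r_g,\ \mathrm{SINR}_P\ge\beta_P),\qquad P_{\rm sec}=\mathbb P\bigl(\mathrm{SINR}_S(y_j)\le\beta_S\ \text{for all } y_j\in\Phi_S\ \big|\ R_e\ge r_g\bigr).$$ \textbf{Corollary (interference-limited regime).} If $\sigma_P^2=\sigma_S^2=0$, then $P_{\rm active}=e^{-\lambda_S\pi r_g^2}$, $$P_{\rm con}=\exp\left(-\left[\lambda_S\pi r_g^2+\frac{2\pi^2\lambda_P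 P_{\rm active}\,\beta_P^{2/\alpha}r_1^2}{\alpha\sin(2\pi/\alpha)}\right]\right),$$ $$P_{\rm sec}=\exp\left(-2\pi\lambda_S\int_{r_g}^\infty \mathcal L_{I_2}(\beta_S r^\alpha)\,r\,dr\right),$$ where $$\mathcal L_{I_2}(s)=\exp\left(-2\pi\lambda_P P_{\rm active}\int_0^{s r_g^{-\alpha}}\frac{s^{2/\alpha}}{\alpha(1+z)z^{2/\alpha}}\,dz\right)$$ (for $r_g=0$ the upper limit is $\infty$), and the integral over $r$ converges. -/

import Mathlib

open MeasureTheory ProbabilityTheory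
open scoped ENNReal NNReal

noncomputable section

namespace GuardZone

/-- The Euclidean plane in which all nodes live. -/
abbrev Plane : Type := EuclideanSpace ℝ (Fin 2)

/-- The number of points of the random sequence `X` that lie in `B`. -/
def count {Ω E : Type*} (X : ℕ → Ω → E) (B : Set E) (ω : Ω) : ℝ≥0∞ :=
  ∑' i, B.indicator (fun _ => (1 : ℝ≥0∞)) (X i ω)

/-- The random points `X 0, X 1, …` form a Poisson point process with intensity measure `ν`:
the number of points in a measurable set `B` of finite `ν`-measure has the Poisson law with mean
`ν B`, and the numbers of points in finitely many pairwise disjoint sets are independent. -/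
structure IsPoissonProcess {Ω E : Type*} [MeasurableSpace Ω] [MeasurableSpace E]
    (X : ℕ → Ω → E) (ν : Measure E) (μ : Measure Ω) : Prop where
  measurable : ∀ i, Measurable (X i)
  law : ∀ B : Set E, MeasurableSet B → ν B ≠ ∞ →
    μ.map (count X B) = (poissonMeasure (ν B).toNNReal).map (fun n : ℕ => (n : ℝ≥0∞))
  indep : ∀ (n : ℕ) (B : Fin n → Set E), (∀ i, MeasurableSet (B i)) →
    Pairwise (fun i j => Disjoint (B i) (B j)) → iIndepFun (fun i => count X (B i)) μ

/-- The deterministic parameters of the system. The typical primary receiver (PR) sits at the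
origin and the typical primary transmitter (PT) at `x₁ ≠ 0`. -/
structure Params where
  /-- density of the PTs -/
  lamP : ℝ
  /-- density of the energy receivers (ERs) -/
  lamS : ℝ
  /-- path-loss exponent -/
  alpha : ℝ
  /-- transmission power of every PT -/
  power : ℝ
  /-- guard zone radius -/
  rg : ℝ
  /-- location of the typical PT -/
  x₁ : Plane
  /-- noise power at the PR -/
  noisePR : ℝ
  /-- noise power at the ERs -/
  noiseER : ℝ
  lamP_pos : 0 < lamP
  lamS_pos : 0 < lamS
  two_lt_alpha : 2 < alpha
  power_pos : 0 < power
  rg_nonneg : 0 ≤ rg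
  x₁_ne_zero : x₁ ≠ 0
  noisePR_nonneg : 0 ≤ noisePR
  noiseER_nonneg : 0 ≤ noiseER

/-- The length of the typical link. -/
def Params.r₁ (p : Params) : ℝ := ‖p.x₁‖

/-- The random elements of the network. Receivers are indexed by `Option ℕ`: `none` is the typical
PR and `some j` is the ER located at `er j`. Each receiver carries its own copy of the interfering
PTs, of their activity marks and of the fading gains: the correlation between the interference
seen at different receivers is ignored. -/
structure Network (Ω : Type*) where
  /-- locations of the ERs -/
  er : ℕ → Ω → Plane
  /-- `pt k i`: location of the `i`-th interfering PT, in the copy of receiver `k` -/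
  pt : Option ℕ → ℕ → Ω → Plane
  /-- `mark k i`: whether that PT is retained as active -/
  mark : Option ℕ → ℕ → Ω → Bool
  /-- `direct k`: fading gain from the typical PT to receiver `k` -/
  direct : Option ℕ → Ω → ℝ
  /-- `cross k i`: fading gain from the `i`-th interfering PT to receiver `k` -/
  cross : Option ℕ → ℕ → Ω → ℝ

namespace Network

variable {Ω : Type*}

/-- Labels of the sources of randomness. -/
inductive Source : Type
  | er : Source
  | pt : Option ℕ → Source
  | mark : Option ℕ → ℕ → Source
  | direct : Option ℕ → Source
  | cross : Option ℕ → ℕ → Source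

/-- The information (σ-algebra) generated by each source of randomness. -/
@[reducible] def info (N : Network Ω) : Source → MeasurableSpace Ω
  | .er => ⨆ j, MeasurableSpace.comap (N.er j) inferInstance
  | .pt k => ⨆ i, MeasurableSpace.comap (N.pt k i) inferInstance
  | .mark k i => MeasurableSpace.comap (N.mark k i) inferInstance
  | .direct k => MeasurableSpace.comap (N.direct k) inferInstance
  | .cross k i => MeasurableSpace.comap (N.cross k i) inferInstance

/-- The distance `R_e` between the typical PT and its nearest ER. -/
def nearestER (N : Network Ω) (p : Params) (ω : Ω) : ℝ≥0∞ :=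
  ⨅ j, edist p.x₁ (N.er j ω)

/-- The event `R_e ≥ r_g`: no ER lies in the guard zone of the typical PT. -/
def clear (N : Network Ω) (p : Params) : Set Ω :=
  {ω | ENNReal.ofReal p.rg ≤ N.nearestER p ω}

/-- `P_active = ℙ(R_e ≥ r_g)`. -/
def pActive [MeasurableSpace Ω] (N : Network Ω) (p : Params) (μ : Measure Ω) : ℝ :=
  μ.real (N.clear p)

/-- The distributional specification of the network: the ERs and (for each receiver) the PTs are
homogeneous Poisson processes, all fading gains are exponential with mean one, a PT is retained as
active with probability `P_active`, and all these random elements are mutually independent. -/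
structure IsModel [MeasurableSpace Ω] (N : Network Ω) (p : Params) (μ : Measure Ω) : Prop where
  er_poisson : IsPoissonProcess N.er (ENNReal.ofReal p.lamS • volume) μ
  pt_poisson : ∀ k, IsPoissonProcess (N.pt k) (ENNReal.ofReal p.lamP • volume) μ
  mark_measurable : ∀ k i, Measurable (N.mark k i)
  mark_law : ∀ k i, μ.real {ω | N.mark k i ω = true} = N.pActive p μ
  direct_measurable : ∀ k, Measurable (N.direct k)
  direct_law : ∀ k, μ.map (N.direct k) = expMeasure 1
  cross_measurable : ∀ k i, Measurable (N.cross k i)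
  cross_law : ∀ k i, μ.map (N.cross k i) = expMeasure 1
  independent : iIndep N.info μ

/-- The location of a receiver. -/
def loc (N : Network Ω) : Option ℕ → Ω → Plane
  | none, _ => 0
  | some j, ω => N.er j ω

/-- The event that the `i`-th PT transmits, as seen by receiver `k`. The PT has to be retained;
moreover a PT closer than `r_g` to an ER is silent, because that ER lies in its guard zone. -/
def active (N : Network Ω) (p : Params) : Option ℕ → ℕ → Set Ω
  | none, i => {ω | N.mark none i ω = true}
  | some j, i => {ω | N.mark (some j) i ω = true ∧ p.rg ≤ dist (N.pt (some j) i ω) (N.er j ω)}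

/-- Power received at `y` from a transmitter at `x` when the fading gain is `h`. -/
def received (p : Params) (h : ℝ) (x y : Plane) : ℝ≥0∞ :=
  ENNReal.ofReal p.power * ENNReal.ofReal h * edist x y ^ (-p.alpha)

/-- Total interference power at receiver `k`. -/
def interference (N : Network Ω) (p : Params) (k : Option ℕ) (ω : Ω) : ℝ≥0∞ :=
  ∑' i, (N.active p k i).indicator (fun ω => received p (N.cross k i ω) (N.pt k i ω) (N.loc k ω)) ω

/-- Noise power at a receiver. -/
def noise (p : Params) : Option ℕ → ℝ
  | none => p.noisePR
  | some _ => p.noiseER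

/-- The signal-to-interference-plus-noise ratio at receiver `k`, for the signal of the typical
PT. -/
def sinr (N : Network Ω) (p : Params) (k : Option ℕ) (ω : Ω) : ℝ≥0∞ :=
  received p (N.direct k ω) p.x₁ (N.loc k ω) /
    (N.interference p k ω + ENNReal.ofReal (noise p k))

variable [MeasurableSpace Ω]

/-- Probability of successful connection: `ℙ(R_e ≥ r_g, SINR_P ≥ β)`. -/
def pCon (N : Network Ω) (p : Params) (μ : Measure Ω) (β : ℝ) : ℝ :=
  μ.real {ω | ω ∈ N.clear p ∧ ENNReal.ofReal β ≤ N.sinr p none ω}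

/-- Secure communication probability: given `R_e ≥ r_g`, the probability that the SINR at every ER
is at most `β`. -/
def pSec (N : Network Ω) (p : Params) (μ : Measure Ω) (β : ℝ) : ℝ :=
  (μ[|N.clear p]).real {ω | ∀ j, N.sinr p (some j) ω ≤ ENNReal.ofReal β}

end Network

/-- `exp (-2πλ ∫₀^{s r_g^{-α}} s^{2/α} / (α (1+z) z^{2/α}) dz)`, where the upper limit of
integration is `∞` if `r_g = 0 < s`. -/
def laplaceI₂ (lam rg α s : ℝ) : ℝ :=
  Real.exp (-(2 * Real.pi * lam *
    ∫ z in {z : ℝ | 0 < z ∧ ENNReal.ofReal z ≤ ENNReal.ofReal s / ENNReal.ofReal rg ^ α},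
      s ^ (2 / α) / (α * (1 + z) * z ^ (2 / α))))

end GuardZone

end

/-! The proof rests on the generating functional of an independently marked Poisson process
(`IsPoissonProcess.lintegral_marked`). For `0 ≤ f ≤ 1`, if `q x` is the mean of `f x W` over a mark
`W`, then `E ∏ f (X i) (W i) = exp (-∫ (1 - q) dν)`. The marks are averaged out one at a time, and
the Laplace functional `IsPoissonProcess.lintegral_expNeg_tsum` is then applied to `-log q`. Working
with `expNeg` on `[0, ∞]` lets infinite sums and vanishing factors through without exceptions.

This is used twice. At a fixed receiver the points are the interferers, marked by activity and
fading gain. Averaging the factor of an interferer at distance `d` beyond the guard radius gives `1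
- q = P c / (1 + c)` with `c = s d ^ (-α)`. Polar coordinates and the substitution `z = s r ^ (-α)`
turn the exponent into that of `laplaceI₂`. Since the direct gain is exponential and independent of
the interference `J`, the probability that the ratio exceeds `β` is `E exp (-β d ^ α J)`, a value of
this Laplace transform. At the PR there is no guard radius, Euler's integral makes the exponent
explicit, and the event `R_e ≥ r_g`, which depends on the ERs only, contributes an independent void
probability.

The second use is for the ERs, each marked by the whole state of its receiver, with `f` the
indicator that the ER is outside the guard zone and does not decode. Here `1 - q` is `1` on the
guard disc and `laplaceI₂` outside, so the joint probability has exponent `-(λ_S π r_g² + 2π λ_S ∫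
laplaceI₂ · r dr)`; conditioning removes the first term. The radial integral converges by the
Gaussian bound `laplaceI₂_le_exp`. -/

noncomputable section

namespace GuardZone

open Filter Topology

/-! ### The exponential on the extended half-line -/

/-- The function `x ↦ exp (-x)` on `[0, ∞]`, with value `0` at `∞`. -/
def expNeg (x : ℝ≥0∞) : ℝ≥0∞ := EReal.exp (-(x : EReal))

/-- A right inverse of `expNeg` on `[0, 1]`. -/
def negLog (x : ℝ≥0∞) : ℝ≥0∞ := (-ENNReal.log x).toENNReal

@[simp] lemma expNeg_zero : expNeg 0 = 1 := by simp [expNeg]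

@[simp] lemma expNeg_top : expNeg ∞ = 0 := by simp [expNeg]

lemma expNeg_ofReal {x : ℝ} (hx : 0 ≤ x) :
    expNeg (ENNReal.ofReal x) = ENNReal.ofReal (Real.exp (-x)) := by
  rw [expNeg, EReal.coe_ennreal_ofReal, max_eq_left hx, ← EReal.coe_neg, EReal.exp_coe]

lemma expNeg_coe (x : ℝ≥0) : expNeg x = ENNReal.ofReal (Real.exp (-x)) := by
  rw [← ENNReal.ofReal_coe_nnreal, expNeg_ofReal x.coe_nonneg]

lemma expNeg_add (x y : ℝ≥0∞) : expNeg (x + y) = expNeg x * expNeg y := by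
  rw [expNeg, expNeg, expNeg, ← EReal.exp_add, EReal.coe_ennreal_add, EReal.neg_add]
  · rw [sub_eq_add_neg]
  · left; simp
  · right; simp

lemma expNeg_sum {ι : Type*} (s : Finset ι) (f : ι → ℝ≥0∞) :
    expNeg (∑ i ∈ s, f i) = ∏ i ∈ s, expNeg (f i) := by
  classical
  induction s using Finset.induction_on with
  | empty => simp
  | insert a s ha ih => rw [Finset.sum_insert ha, Finset.prod_insert ha, expNeg_add, ih]

lemma continuous_expNeg : Continuous expNeg :=
  ENNReal.continuous_exp.comp (continuous_neg.comp continuous_coe_ennreal_ereal)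

lemma measurable_expNeg : Measurable expNeg := continuous_expNeg.measurable

lemma antitone_expNeg : Antitone expNeg := fun _ _ h =>
  EReal.exp_monotone (EReal.neg_le_neg_iff.2 (EReal.coe_ennreal_le_coe_ennreal_iff.2 h))

lemma expNeg_le_one (x : ℝ≥0∞) : expNeg x ≤ 1 := by
  simpa using antitone_expNeg (bot_le : 0 ≤ x)

lemma measurable_negLog : Measurable negLog :=
  measurable_ereal_toENNReal.comp (continuous_neg.measurable.comp ENNReal.measurable_log)

lemma expNeg_negLog {x : ℝ≥0∞} (hx : x ≤ 1) : expNeg (negLog x) = x := by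
  rw [expNeg, negLog, EReal.coe_toENNReal, neg_neg, ENNReal.exp_log]
  rw [EReal.neg_nonneg]
  simpa using ENNReal.log_monotone hx

/-- Continuity of `expNeg` up to `∞` covers divergent series as well: the partial products then tend
to `0`. -/
lemma tendsto_prod_expNeg (f : ℕ → ℝ≥0∞) :
    Tendsto (fun n => ∏ i ∈ Finset.range n, expNeg (f i)) atTop (𝓝 (expNeg (∑' i, f i))) := by
  simp_rw [← expNeg_sum]
  exact (continuous_expNeg.tendsto _).comp ENNReal.summable.hasSum.tendsto_sum_nat

lemma lintegral_expNeg_mul_poissonMeasure (a l : ℝ≥0) :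
    ∫⁻ n : ℕ, expNeg (a * n) ∂poissonMeasure l = expNeg ((1 - expNeg a) * l) := by
  have hl : ∀ n : ℕ, expNeg (a * n) = ENNReal.ofReal (Real.exp (-a) ^ n) := fun n => by
    rw [← Real.exp_nat_mul, show (n : ℝ) * -(a : ℝ) = -((a * n : ℝ≥0) : ℝ) by push_cast; ring,
      ← expNeg_coe]
    push_cast; rfl
  have hr : (1 - expNeg a) * (l : ℝ≥0∞) = ENNReal.ofReal ((1 - Real.exp (-a)) * l) := by
    rw [expNeg_coe, ← ENNReal.ofReal_one, ← ENNReal.ofReal_sub _ (Real.exp_pos _).le,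
      ENNReal.ofReal_mul, ENNReal.ofReal_coe_nnreal]
    simp
  -- The exponential series at `l * exp (-a)`, multiplied by `exp (-l)`.
  have hs : HasSum (fun n : ℕ => Real.exp (-l) * l ^ n / n.factorial * Real.exp (-a) ^ n)
      (Real.exp (-((1 - Real.exp (-a)) * l))) := by
    have := (NormedSpace.expSeries_div_hasSum_exp (l * Real.exp (-a) : ℝ)).mul_left
      (Real.exp (-l))
    rw [← Real.exp_eq_exp_ℝ, ← Real.exp_add] at this
    convert! this using 1
    · ext n; rw [mul_pow]; ring
    · congr 1; ring
  rw [lintegral_countable', hr, expNeg_ofReal, ← hs.tsum_eq, ENNReal.ofReal_tsum_of_nonneg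
    (fun n => by positivity) hs.summable]
  · refine tsum_congr fun n => ?_
    rw [hl, poissonMeasure_singleton, mul_comm, ← ENNReal.ofReal_mul (by positivity)]
  · exact mul_nonneg (by simp) l.2

/-! ### Laplace functional of a Poisson process -/

section Poisson

variable {Ω E : Type*} [MeasurableSpace Ω] [MeasurableSpace E] {X : ℕ → Ω → E} {ν : Measure E}
  {μ : Measure Ω}

lemma measurable_count (hX : ∀ i, Measurable (X i)) {B : Set E} (hB : MeasurableSet B) :
    Measurable (count X B) :=
  Measurable.tsum fun i => (measurable_const.indicator hB).comp (hX i)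

/-- The Poisson law is only available for sets of finite measure. The alternative `r = 0` is needed
for the zero level of a simple function, which may have infinite measure; both sides are then `1`.
-/
lemma IsPoissonProcess.lintegral_expNeg_count (hX : IsPoissonProcess X ν μ)
    [IsProbabilityMeasure μ] {B : Set E} (hB : MeasurableSet B) {r : ℝ≥0∞} (hr : r ≠ ∞)
    (h : r = 0 ∨ ν B ≠ ∞) :
    ∫⁻ ω, expNeg (r * count X B ω) ∂μ = expNeg ((1 - expNeg r) * ν B) := by
  rcases h with rfl | h
  · simp
  lift r to ℝ≥0 using hr
  rw [← lintegral_map (f := fun t => expNeg (r * t)) (g := count X B)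
    (measurable_expNeg.comp (measurable_const.mul measurable_id)) (measurable_count hX.measurable hB),
    hX.law B hB h, lintegral_map (f := fun t => expNeg (r * t))
    (measurable_expNeg.comp (measurable_const.mul measurable_id)) .of_discrete, lintegral_expNeg_mul_poissonMeasure, ENNReal.coe_toNNReal h]

/-- The level sets of `s` are disjoint, so their counts are independent and the expectation factors
over the values of `s`. -/
lemma IsPoissonProcess.lintegral_expNeg_tsum_simpleFunc (hX : IsPoissonProcess X ν μ)
    [IsProbabilityMeasure μ] (s : SimpleFunc E ℝ≥0∞) (htop : ∀ x, s x ≠ ∞)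
    (hfin : ∀ r ≠ 0, ν (s ⁻¹' {r}) ≠ ∞) :
    ∫⁻ ω, expNeg (∑' i, s (X i ω)) ∂μ = expNeg (∫⁻ x, (1 - expNeg (s x)) ∂ν) := by
  set n := s.range.card
  let e : Fin n ≃ s.range := s.range.equivFin.symm
  let B : Fin n → Set E := fun i => s ⁻¹' {(e i : ℝ≥0∞)}
  have hB : ∀ i, MeasurableSet (B i) := fun i => s.measurableSet_preimage _
  have hdisj : Pairwise (fun i j => Disjoint (B i) (B j)) := fun i j hij =>
    Set.disjoint_left.2 fun x hi hj => hij (e.injective (Subtype.ext (hi.symm.trans hj)))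
  have hs : ∀ x, s x = ∑ i, (e i : ℝ≥0∞) * (B i).indicator (fun _ => 1) x := fun x => by
    obtain ⟨i₀, hi₀⟩ := e.surjective ⟨s x, s.mem_range_self x⟩
    rw [Finset.sum_eq_single i₀]
    · simp [B, hi₀]
    · intro i _ hi
      rw [Set.indicator_of_notMem, mul_zero]
      intro hx
      exact hi (e.injective (by rw [hi₀]; exact Subtype.ext hx.symm))
    · simp
  have hsum : ∀ ω, ∑' i, s (X i ω) = ∑ j, (e j : ℝ≥0∞) * count X (B j) ω := fun ω => by
    simp_rw [count, ← ENNReal.tsum_mul_left]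
    rw [← Summable.tsum_finsetSum fun _ _ => ENNReal.summable]
    exact tsum_congr fun i => hs _
  have hind : iIndepFun (fun j ω => expNeg ((e j : ℝ≥0∞) * count X (B j) ω)) μ :=
    (hX.indep n B hB hdisj).comp (fun j t => expNeg ((e j : ℝ≥0∞) * t))
      fun j => measurable_expNeg.comp (measurable_const.mul measurable_id)
  have hint : ∫⁻ x, (1 - expNeg (s x)) ∂ν =
      ∑ j, (1 - expNeg (e j : ℝ≥0∞)) * ν (B j) := by
    have := SimpleFunc.map_lintegral (μ := ν) (fun r => 1 - expNeg r) s
    rw [← SimpleFunc.lintegral_eq_lintegral] at this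
    refine Eq.trans (by rfl) (this.trans ?_)
    rw [← Finset.sum_coe_sort, ← e.sum_comp]
  simp_rw [hsum, expNeg_sum]
  rw [lintegral_prod_eq_prod_lintegral_of_indepFun _ _ hind fun j => measurable_expNeg.comp
    (measurable_const.mul (measurable_count hX.measurable (hB j))), hint, expNeg_sum]
  refine Finset.prod_congr rfl fun j _ => hX.lintegral_expNeg_count (hB j) ?_ ?_
  · obtain ⟨x, hx⟩ := SimpleFunc.mem_range.1 (e j).2
    exact hx ▸ htop x
  · exact or_iff_not_imp_left.2 fun h => hfin _ h

/-- The Laplace functional of a Poisson process. -/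
theorem IsPoissonProcess.lintegral_expNeg_tsum (hX : IsPoissonProcess X ν μ)
    [IsProbabilityMeasure μ] [SigmaFinite ν] {g : E → ℝ≥0∞} (hg : Measurable g) :
    ∫⁻ ω, expNeg (∑' i, g (X i ω)) ∂μ = expNeg (∫⁻ x, (1 - expNeg (g x)) ∂ν) := by
  -- Cutting off to the spanning sets gives every nonzero level finite `ν`-measure.
  let s : ℕ → SimpleFunc E ℝ≥0∞ := fun n =>
    (SimpleFunc.eapprox g n).restrict (spanningSets ν n)
  have hs : ∀ n x, s n x = (spanningSets ν n).indicator (SimpleFunc.eapprox g n) x := fun n x => by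
    rw [SimpleFunc.restrict_apply _ (measurableSet_spanningSets ν n)]
  have hmono : ∀ x, Monotone fun n => s n x := fun x m n hmn => by
    simp only [hs]
    by_cases hx : x ∈ spanningSets ν m
    · rw [Set.indicator_of_mem hx, Set.indicator_of_mem (monotone_spanningSets ν hmn hx)]
      exact SimpleFunc.monotone_eapprox g hmn x
    · rw [Set.indicator_of_notMem hx]; exact bot_le
  have hlim : ∀ x, Tendsto (fun n => s n x) atTop (𝓝 (g x)) := fun x => by
    refine (SimpleFunc.tendsto_eapprox hg x).congr' ?_
    filter_upwards [eventually_ge_atTop (spanningSetsIndex ν x)] with n hn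
    rw [hs, Set.indicator_of_mem (mem_spanningSets_of_index_le ν x hn)]
  have key : ∀ n, ∫⁻ ω, expNeg (∑' i, s n (X i ω)) ∂μ =
      expNeg (∫⁻ x, (1 - expNeg (s n x)) ∂ν) := fun n => by
    refine hX.lintegral_expNeg_tsum_simpleFunc (s n) (fun x => ?_) fun r hr => ?_
    · rw [hs]
      exact ((Set.indicator_le_self _ _ x).trans_lt (SimpleFunc.eapprox_lt_top g n x)).ne
    · refine ((measure_mono fun x hx => ?_).trans_lt (measure_spanningSets_lt_top ν n)).ne
      by_contra hxn
      rw [Set.mem_preimage, Set.mem_singleton_iff, hs, Set.indicator_of_notMem hxn] at hx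
      exact hr hx.symm
  refine tendsto_nhds_unique (f := fun n => ∫⁻ ω, expNeg (∑' i, s n (X i ω)) ∂μ) (l := atTop) ?_ ?_
  · refine tendsto_lintegral_of_dominated_convergence (fun _ => 1) (fun n => ?_)
      (fun n => ae_of_all _ fun ω => expNeg_le_one _) (by simp) (ae_of_all _ fun ω => ?_)
    · exact measurable_expNeg.comp (Measurable.tsum fun i =>
        (s n).measurable.comp (hX.measurable i))
    · refine (continuous_expNeg.tendsto _).comp ?_
      -- Series become integrals against counting measure, so that monotone convergence applies.
      simp_rw [← lintegral_count]
      exact lintegral_tendsto_of_tendsto_of_monotone (fun n => .of_discrete)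
        (ae_of_all _ fun i => hmono _) (ae_of_all _ fun i => hlim _)
  · simp_rw [key]
    refine (continuous_expNeg.tendsto _).comp ?_
    refine lintegral_tendsto_of_tendsto_of_monotone (fun n => ?_) (ae_of_all _ fun x m n hmn => ?_)
      (ae_of_all _ fun x => ?_)
    · exact (measurable_const.sub (measurable_expNeg.comp (s n).measurable)).aemeasurable
    · exact tsub_le_tsub_left (antitone_expNeg (hmono x hmn)) 1
    · exact ENNReal.Tendsto.sub tendsto_const_nhds ((continuous_expNeg.tendsto _).comp (hlim x))
        (by simp)

end Poisson

/-! ### Independent marking -/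

section Marking

/-- The joint law of `Y` and `W` is a product, so Tonelli allows `W` to be averaged with `Y` frozen.
-/
lemma lintegral_comp_of_indep {Ω α β : Type*} {m m' mΩ : MeasurableSpace Ω} [MeasurableSpace α]
    [MeasurableSpace β] {μ : Measure Ω} [IsProbabilityMeasure μ] (hm : m ≤ mΩ) (hm' : m' ≤ mΩ)
    (h : Indep m m' μ) {Y : Ω → α} (hY : Measurable[m] Y) {W : Ω → β} (hW : Measurable[m'] W)
    {F : α → β → ℝ≥0∞} (hF : Measurable (Function.uncurry F)) :
    ∫⁻ ω, F (Y ω) (W ω) ∂μ = ∫⁻ ω, ∫⁻ ω', F (Y ω) (W ω') ∂μ ∂μ := by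
  have hY' : Measurable Y := hY.mono hm le_rfl
  have hW' : Measurable W := hW.mono hm' le_rfl
  have hYW : IndepFun Y W μ :=
    indep_of_indep_of_le h hY.comap_le hW.comap_le
  have hmap := (indepFun_iff_map_prod_eq_prod_map_map hY'.aemeasurable hW'.aemeasurable).1 hYW
  have : IsProbabilityMeasure (μ.map W) := Measure.isProbabilityMeasure_map hW'.aemeasurable
  calc ∫⁻ ω, F (Y ω) (W ω) ∂μ
      = ∫⁻ z, Function.uncurry F z ∂(μ.map fun ω => (Y ω, W ω)) := by
        rw [lintegral_map hF (hY'.prodMk hW')]; rfl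
    _ = ∫⁻ y, ∫⁻ w, F y w ∂(μ.map W) ∂(μ.map Y) := by
        rw [hmap, lintegral_prod _ hF.aemeasurable]; rfl
    _ = ∫⁻ y, ∫⁻ ω', F y (W ω') ∂μ ∂(μ.map Y) :=
        lintegral_congr fun y => lintegral_map (hF.comp measurable_prodMk_left) hW'
    _ = ∫⁻ ω, ∫⁻ ω', F (Y ω) (W ω') ∂μ ∂μ := by
        rw [lintegral_map _ hY']
        exact Measurable.lintegral_prod_right' (f := fun z : α × Ω => F z.1 (W z.2))
          (hF.comp (measurable_fst.prodMk (hW'.comp measurable_snd)))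

variable {Ω E S : Type*} {m : MeasurableSpace Ω} {m' : ℕ → MeasurableSpace Ω}
  {mΩ : MeasurableSpace Ω} [MeasurableSpace E] [MeasurableSpace S] {μ : Measure Ω}
  [IsProbabilityMeasure μ] {X : ℕ → Ω → E} {W : ℕ → Ω → S} {f : E → S → ℝ≥0∞} {q : E → ℝ≥0∞}

/-- Induction on `n`: the last mark is independent of the points and the earlier marks, so averaging
it replaces its factor by `q (X n)`. That factor is `m`-measurable and is absorbed into the weight
`H`, which is why `H` is present. -/
lemma lintegral_prod_marks (hm : m ≤ mΩ) (hm' : ∀ i, m' i ≤ mΩ)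
    (hind : ∀ n, Indep (m ⊔ ⨆ i ∈ Finset.range n, m' i) (m' n) μ)
    (hX : ∀ i, Measurable[m] (X i)) (hW : ∀ i, Measurable[m' i] (W i))
    (hf : Measurable (Function.uncurry f)) (hqm : Measurable q)
    (hq : ∀ i x, ∫⁻ ω, f x (W i ω) ∂μ = q x) (n : ℕ) {H : Ω → ℝ≥0∞} (hH : Measurable[m] H) :
    ∫⁻ ω, H ω * ∏ i ∈ Finset.range n, f (X i ω) (W i ω) ∂μ =
      ∫⁻ ω, H ω * ∏ i ∈ Finset.range n, q (X i ω) ∂μ := by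
  induction n generalizing H with
  | zero => simp
  | succ n ih =>
    have hle : m ⊔ ⨆ i ∈ Finset.range n, m' i ≤ mΩ := sup_le hm (iSup₂_le fun i _ => hm' i)
    have hXn : ∀ i, Measurable[m ⊔ ⨆ i ∈ Finset.range n, m' i] (X i) := fun i =>
      (hX i).mono le_sup_left le_rfl
    have hY : Measurable[m ⊔ ⨆ i ∈ Finset.range n, m' i]
        fun ω => (H ω * ∏ i ∈ Finset.range n, f (X i ω) (W i ω), X n ω) := by
      refine Measurable.prodMk (Measurable.mul (hH.mono le_sup_left le_rfl)
        (Finset.measurable_fun_prod _ fun i hi => ?_)) (hXn n)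
      exact hf.comp ((hXn i).prodMk ((hW i).mono
        ((le_iSup₂ (f := fun i (_ : i ∈ Finset.range n) => m' i) i hi).trans le_sup_right) le_rfl))
    have := lintegral_comp_of_indep hle (hm' n) (hind n) hY (hW n)
      (F := fun y w => y.1 * f y.2 w) (measurable_fst.fst.mul
        (hf.comp (measurable_fst.snd.prodMk measurable_snd)))
    simp only [Finset.prod_range_succ, ← mul_assoc]
    rw [this]
    have hstep : ∀ ω, ∫⁻ ω', (H ω * ∏ i ∈ Finset.range n, f (X i ω) (W i ω)) *
        f (X n ω) (W n ω') ∂μ = H ω * q (X n ω) * ∏ i ∈ Finset.range n, f (X i ω) (W i ω) := by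
      intro ω
      rw [lintegral_const_mul (f := fun ω' => f (X n ω) (W n ω')) _
        (hf.comp (measurable_const.prodMk ((hW n).mono (hm' n) le_rfl))), hq]
      ring
    simp_rw [hstep]
    rw [ih (H := fun ω => H ω * q (X n ω)) (hH.fun_mul (hqm.comp (hX n)))]
    exact lintegral_congr fun ω => by ring

/-- The generating functional of an independently marked Poisson process. -/
theorem IsPoissonProcess.lintegral_marked {ν : Measure E} [SigmaFinite ν]
    (hP : IsPoissonProcess X ν μ) (hm : m ≤ mΩ) (hm' : ∀ i, m' i ≤ mΩ)
    (hind : ∀ n, Indep (m ⊔ ⨆ i ∈ Finset.range n, m' i) (m' n) μ)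
    (hX : ∀ i, Measurable[m] (X i)) (hW : ∀ i, Measurable[m' i] (W i))
    (hf : Measurable (Function.uncurry f)) (hf1 : ∀ x w, f x w ≤ 1)
    (hq : ∀ i x, ∫⁻ ω, f x (W i ω) ∂μ = q x) {Z : Ω → ℝ≥0∞}
    (hZ : ∀ ω, Tendsto (fun n => ∏ i ∈ Finset.range n, f (X i ω) (W i ω)) atTop (𝓝 (Z ω))) :
    ∫⁻ ω, Z ω ∂μ = expNeg (∫⁻ x, (1 - q x) ∂ν) := by
  have hW' : ∀ i, Measurable (W i) := fun i => (hW i).mono (hm' i) le_rfl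
  have hqm : Measurable q := by
    simp_rw [← funext (hq 0)]
    exact Measurable.lintegral_prod_right' (f := fun z : E × Ω => f z.1 (W 0 z.2))
      (hf.comp (measurable_fst.prodMk ((hW' 0).comp measurable_snd)))
  have hq1 : ∀ x, q x ≤ 1 := fun x => by
    rw [← hq 0]
    exact (lintegral_mono fun ω => hf1 x _).trans (by simp)
  -- Writing `q` as `expNeg` of `-log q` reduces the product to the Laplace functional; zeros of `q`
  -- correspond to the value `∞`.
  have hexp : ∀ x, expNeg (negLog (q x)) = q x := fun x => expNeg_negLog (hq1 x)
  have h1 := hP.lintegral_expNeg_tsum (measurable_negLog.comp hqm)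
  simp only [Function.comp_apply, hexp] at h1
  rw [← h1]
  refine tendsto_nhds_unique
    (f := fun n => ∫⁻ ω, ∏ i ∈ Finset.range n, f (X i ω) (W i ω) ∂μ) (l := atTop) ?_ ?_
  · exact tendsto_lintegral_of_dominated_convergence (fun _ => 1)
      (fun n => Finset.measurable_fun_prod _ fun i _ =>
        hf.comp ((hP.measurable i).prodMk (hW' i)))
      (fun n => ae_of_all _ fun ω => Finset.prod_le_one' fun i _ => hf1 _ _)
      (by simp) (ae_of_all _ hZ)
  · have h2 : ∀ n, ∫⁻ ω, ∏ i ∈ Finset.range n, f (X i ω) (W i ω) ∂μ =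
        ∫⁻ ω, ∏ i ∈ Finset.range n, q (X i ω) ∂μ := fun n => by
      simpa using lintegral_prod_marks hm hm' hind hX hW hf hqm hq n
        (H := fun _ => 1) measurable_const
    simp_rw [h2]
    refine tendsto_lintegral_of_dominated_convergence (fun _ => 1)
      (fun n => Finset.measurable_fun_prod _ fun i _ => hqm.comp (hP.measurable i))
      (fun n => ae_of_all _ fun ω => Finset.prod_le_one' fun i _ => hq1 _)
      (by simp) (ae_of_all _ fun ω => ?_)
    simpa only [hexp] using tendsto_prod_expNeg fun i => negLog (q (X i ω))

end Marking

/-! ### The exponential law -/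

section Exponential

lemma lintegral_expMeasure {f : ℝ → ℝ≥0∞} (hf : Measurable f) :
    ∫⁻ x, f x ∂expMeasure 1 = ∫⁻ x in Set.Ioi 0, ENNReal.ofReal (Real.exp (-x)) * f x := by
  rw [expMeasure, gammaMeasure, lintegral_withDensity_eq_lintegral_mul _
    (f := gammaPDF 1 1)
    (measurable_gammaPDFReal 1 1).ennreal_ofReal hf, ← lintegral_indicator measurableSet_Ioi]
  have h0 : ∀ᵐ x : ℝ, x ≠ 0 := by simp [ae_iff]
  refine lintegral_congr_ae (h0.mono fun x hx => ?_)
  rcases lt_or_gt_of_ne hx with h | h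
  · simp [gammaPDF_eq, h.not_ge, h.not_gt]
  · simp [gammaPDF_eq, h, h.le]

lemma lintegral_Ioi_exp_neg_mul {b : ℝ} (hb : 0 < b) (c : ℝ) :
    ∫⁻ x in Set.Ioi c, ENNReal.ofReal (Real.exp (-b * x)) =
      ENNReal.ofReal (Real.exp (-b * c) / b) := by
  rw [← ofReal_integral_eq_lintegral_ofReal (exp_neg_integrableOn_Ioi c hb)
    (ae_of_all _ fun x => (Real.exp_pos _).le), integral_exp_mul_Ioi (by linarith)]
  congr 1
  field_simp

lemma expMeasure_Ioi {c : ℝ} (hc : 0 ≤ c) :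
    expMeasure 1 (Set.Ioi c) = ENNReal.ofReal (Real.exp (-c)) := by
  rw [← lintegral_indicator_one measurableSet_Ioi,
    lintegral_expMeasure (measurable_one.indicator measurableSet_Ioi)]
  have : ∀ x : ℝ, ENNReal.ofReal (Real.exp (-x)) * (Set.Ioi c).indicator 1 x =
      (Set.Ioi c).indicator (fun x => ENNReal.ofReal (Real.exp (-1 * x))) x := fun x => by
    by_cases hx : x ∈ Set.Ioi c <;> simp [hx]
  simp_rw [this]
  rw [lintegral_indicator measurableSet_Ioi, Measure.restrict_restrict measurableSet_Ioi,
    Set.inter_eq_left.2 (Set.Ioi_subset_Ioi hc), lintegral_Ioi_exp_neg_mul one_pos]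
  simp

lemma ae_pos_expMeasure : ∀ᵐ x ∂expMeasure 1, 0 < x := by
  have := isProbabilityMeasure_expMeasure one_pos
  refine (prob_compl_eq_zero_iff measurableSet_Ioi).2 ?_
  simpa using expMeasure_Ioi le_rfl

lemma expMeasure_Ici {c : ℝ} (hc : 0 ≤ c) :
    expMeasure 1 (Set.Ici c) = ENNReal.ofReal (Real.exp (-c)) := by
  have hac : expMeasure 1 ≪ volume := withDensity_absolutelyContinuous _ _
  rw [← expMeasure_Ioi hc]
  exact measure_congr (hac.ae_le Ioi_ae_eq_Ici.symm)

lemma expMeasure_ofReal_gt (t : ℝ≥0∞) :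
    expMeasure 1 {x | t < ENNReal.ofReal x} = expNeg t := by
  induction t with
  | top => simp
  | coe t =>
    rw [expNeg_coe, ← expMeasure_Ioi t.coe_nonneg]
    congr 1
    ext x
    simp [ENNReal.lt_ofReal_iff_toReal_lt]

lemma expMeasure_ofReal_ge (t : ℝ≥0∞) :
    expMeasure 1 {x | t ≤ ENNReal.ofReal x} = expNeg t := by
  have := isProbabilityMeasure_expMeasure one_pos
  induction t with
  | top => simp
  | coe t =>
    -- At `t = 0` the event is the whole line, not `Set.Ici 0`, because `ENNReal.ofReal` sends
    -- negative numbers to `0`.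
    rcases eq_or_ne t 0 with rfl | ht
    · simp
    rw [expNeg_coe, ← expMeasure_Ici t.coe_nonneg]
    congr 1
    ext x
    rw [Set.mem_ofPred_eq, ← ENNReal.ofReal_coe_nnreal, ENNReal.ofReal_le_ofReal_iff', Set.mem_Ici,
      or_iff_left (not_le.2 (NNReal.coe_pos.2 (pos_iff_ne_zero.2 ht)))]

/-- The Laplace transform of the exponential law. -/
lemma lintegral_expNeg_expMeasure (c : ℝ≥0∞) :
    ∫⁻ x, expNeg (c * ENNReal.ofReal x) ∂expMeasure 1 = (1 + c)⁻¹ := by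
  rw [lintegral_expMeasure (f := fun x => expNeg (c * ENNReal.ofReal x))
    (measurable_expNeg.comp (measurable_const.mul ENNReal.measurable_ofReal))]
  induction c with
  | top =>
    rw [setLIntegral_congr_fun (g := fun _ => 0) measurableSet_Ioi fun x hx => ?_]
    · simp
    · simp [ENNReal.top_mul (ENNReal.ofReal_pos.2 hx).ne']
  | coe c =>
    rw [setLIntegral_congr_fun (g := fun x => ENNReal.ofReal (Real.exp (-(1 + c) * x)))
      measurableSet_Ioi fun x hx => ?_]
    · rw [lintegral_Ioi_exp_neg_mul (by positivity), mul_zero, Real.exp_zero, one_div,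
        ENNReal.ofReal_inv_of_pos (by positivity), ENNReal.ofReal_add one_pos.le c.coe_nonneg]
      simp
    · have hx : (0 : ℝ) ≤ x := le_of_lt hx
      simp only
      rw [← ENNReal.ofReal_coe_nnreal, ← ENNReal.ofReal_mul c.coe_nonneg, expNeg_ofReal
        (mul_nonneg c.coe_nonneg hx), ← ENNReal.ofReal_mul (Real.exp_pos _).le, ← Real.exp_add]
      congr 2
      ring

end Exponential

/-! ### Euler's integral and the radial form of the Laplace exponent -/

section Integrals

/-- Euler's integral `∫₀^∞ t^{-a} / (1 + t) dt = π / sin (π a)`. -/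
lemma integral_rpow_neg_div_one_add {a : ℝ} (ha : 0 < a) (ha1 : a < 1) :
    ∫ t in Set.Ioi (0 : ℝ), t ^ (-a) / (1 + t) = Real.pi / Real.sin (Real.pi * a) := by
  -- The substitution `t = x / (1 - x)` yields the beta integral `B (1 - a, a)`, which the
  -- reflection formula evaluates.
  have himage : (fun x : ℝ => x / (1 - x)) '' Set.Ioo 0 1 = Set.Ioi 0 := by
    ext t
    refine ⟨?_, fun ht => ?_⟩
    · rintro ⟨x, hx, rfl⟩
      exact div_pos hx.1 (sub_pos.2 hx.2)
    · have ht : 0 < t := ht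
      refine ⟨t / (1 + t), ⟨by positivity, (div_lt_one (by positivity)).2 (by linarith)⟩, ?_⟩
      field_simp
      ring
  have hderiv : ∀ x ∈ Set.Ioo (0 : ℝ) 1,
      HasDerivWithinAt (fun x : ℝ => x / (1 - x)) (1 / (1 - x) ^ 2) (Set.Ioo 0 1) x := by
    intro x hx
    have h1 : 1 - x ≠ 0 := (sub_pos.2 hx.2).ne'
    convert! ((hasDerivAt_id x).div ((hasDerivAt_id x).const_sub 1) h1).hasDerivWithinAt using 1
    simp
  have hinj : Set.InjOn (fun x : ℝ => x / (1 - x)) (Set.Ioo 0 1) := by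
    intro x hx y hy hxy
    have h1 : 1 - x ≠ 0 := (sub_pos.2 hx.2).ne'
    have h2 : 1 - y ≠ 0 := (sub_pos.2 hy.2).ne'
    simp only at hxy
    rw [div_eq_div_iff h1 h2] at hxy
    linarith
  have hsub := integral_image_eq_integral_abs_deriv_smul measurableSet_Ioo hderiv hinj
    fun t : ℝ => t ^ (-a) / (1 + t)
  rw [himage] at hsub
  rw [hsub, ← Real.Gamma_mul_Gamma_one_sub]
  have hbeta := beta_eq_betaIntegralReal (1 - a) a (by linarith) ha
  rw [beta, sub_add_cancel, Real.Gamma_one, div_one, mul_comm] at hbeta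
  have hreal : Complex.betaIntegral ((1 - a : ℝ) : ℂ) (a : ℂ) =
      ((∫ x in (0 : ℝ)..1, x ^ (-a) * (1 - x) ^ (a - 1) : ℝ) : ℂ) := by
    rw [Complex.betaIntegral, ← intervalIntegral.integral_ofReal]
    refine intervalIntegral.integral_congr fun x hx => ?_
    rw [Set.uIcc_of_le zero_le_one] at hx
    simp only [Complex.ofReal_mul, Complex.ofReal_cpow hx.1,
      Complex.ofReal_cpow (sub_nonneg.2 hx.2)]
    push_cast
    congr 2
    ring
  rw [hbeta, hreal, Complex.ofReal_re, intervalIntegral.integral_of_le zero_le_one,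
    integral_Ioc_eq_integral_Ioo]
  refine setIntegral_congr_fun measurableSet_Ioo fun x hx => ?_
  have h1 : 0 < 1 - x := sub_pos.2 hx.2
  have h0 : 0 < x := hx.1
  have h2 : 1 + x / (1 - x) = (1 - x)⁻¹ := by field_simp; ring
  simp only [smul_eq_mul]
  rw [abs_of_pos (by positivity), h2, Real.div_rpow h0.le h1.le, Real.rpow_neg h1.le,
    Real.rpow_sub h1, Real.rpow_one]
  field_simp

/-- Polar coordinates; the circle has length `2π`, the dimension times the area of the unit disc. -/
lemma lintegral_fun_norm {f : ℝ → ℝ≥0∞} (hf : Measurable f) :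
    ∫⁻ x : Plane, f ‖x‖ =
      ENNReal.ofReal (2 * Real.pi) * ∫⁻ r in Set.Ioi (0 : ℝ), ENNReal.ofReal r * f r := by
  have h2 : Module.finrank ℝ Plane = 2 := by simp
  have hf' : Measurable fun z : Metric.sphere (0 : Plane) 1 × Set.Ioi (0 : ℝ) => f z.2 :=
    hf.comp (measurable_subtype_coe.comp measurable_snd)
  calc ∫⁻ x : Plane, f ‖x‖
      = ∫⁻ x : ({(0 : Plane)}ᶜ : Set Plane), f ‖x.1‖ ∂(Measure.comap Subtype.val volume) := by
        rw [lintegral_subtype_comap (measurableSet_singleton _).compl fun x : Plane => f ‖x‖,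
          restrict_compl_singleton]
    _ = ∫⁻ z, f z.2 ∂((volume : Measure Plane).toSphere.prod (.volumeIoiPow (2 - 1))) := by
        have hmp := (volume : Measure Plane).measurePreserving_homeomorphUnitSphereProd
        rw [h2] at hmp
        rw [← hmp.lintegral_comp hf']
        simp
    _ = (volume : Measure Plane).toSphere Set.univ *
          ∫⁻ r : Set.Ioi (0 : ℝ), f r ∂.volumeIoiPow (2 - 1) := by
        rw [lintegral_prod _ hf'.aemeasurable]
        simp only
        rw [lintegral_const, mul_comm]
    _ = _ := by
        rw [Measure.toSphere_apply_univ, h2, EuclideanSpace.volume_ball_fin_two,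
          Measure.volumeIoiPow, lintegral_withDensity_eq_lintegral_mul
          (g := fun r : Set.Ioi (0 : ℝ) => f r) _ (by fun_prop) (hf.comp measurable_subtype_coe)]
        simp only [Pi.mul_apply]
        rw [lintegral_subtype_comap measurableSet_Ioi
          fun r : ℝ => ENNReal.ofReal (r ^ (2 - 1)) * f r]
        simp [ENNReal.ofReal_mul]

/-- The range of integration in `laplaceI₂`. -/
def laplaceRange (rg α s : ℝ) : Set ℝ :=
  {z : ℝ | 0 < z ∧ ENNReal.ofReal z ≤ ENNReal.ofReal s / ENNReal.ofReal rg ^ α}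

lemma measurableSet_laplaceRange (rg α s : ℝ) : MeasurableSet (laplaceRange rg α s) :=
  (measurableSet_lt measurable_const measurable_id).inter
    (measurableSet_le ENNReal.measurable_ofReal measurable_const)

/-- The map `r ↦ s * r ^ (-α)` is decreasing, so it carries the radii beyond the guard radius onto
the range of integration. For `rg = 0` the bound is a positive number divided by `0`, hence `∞`. -/
lemma mem_laplaceRange {rg α s r : ℝ} (hrg : 0 ≤ rg) (hα : 0 < α) (hs : 0 < s) (hr : 0 < r) :
    s * r ^ (-α) ∈ laplaceRange rg α s ↔ rg ≤ r := by
  have hpos : 0 < s * r ^ (-α) := by positivity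
  rcases hrg.eq_or_lt with rfl | hrg
  · simp [laplaceRange, hpos, hr.le, ENNReal.zero_rpow_of_pos hα, ENNReal.div_zero, hs]
  · rw [laplaceRange, Set.mem_ofPred_eq, and_iff_right hpos, ENNReal.ofReal_rpow_of_pos hrg,
      ← ENNReal.ofReal_div_of_pos (by positivity), ENNReal.ofReal_le_ofReal_iff (by positivity),
      div_eq_mul_inv, mul_le_mul_iff_right₀ hs, Real.rpow_neg hr.le,
      inv_le_inv₀ (by positivity) (by positivity), Real.rpow_le_rpow_iff hrg.le hr.le hα]

/-- A non-integrable function has integral `0` by convention, whereas Euler's value is positive. -/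
lemma integrableOn_rpow_neg_div_one_add {a : ℝ} (ha : 0 < a) (ha1 : a < 1) :
    IntegrableOn (fun t : ℝ => t ^ (-a) / (1 + t)) (Set.Ioi 0) := by
  refine Integrable.of_integral_ne_zero ?_
  rw [integral_rpow_neg_div_one_add ha ha1]
  have : 0 < Real.sin (Real.pi * a) :=
    Real.sin_pos_of_pos_of_lt_pi (by positivity) (by nlinarith [Real.pi_pos])
  positivity

lemma laplace_integrand_eq {α s z : ℝ} (hz : 0 < z) :
    s ^ (2 / α) / (α * (1 + z) * z ^ (2 / α)) = s ^ (2 / α) / α * (z ^ (-(2 / α)) / (1 + z)) := by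
  rw [Real.rpow_neg hz.le]
  have : (1 + z) ≠ 0 := by positivity
  have : z ^ (2 / α) ≠ 0 := by positivity
  field_simp

lemma integrableOn_laplace_integrand {α s : ℝ} (hα : 2 < α) :
    IntegrableOn (fun z => s ^ (2 / α) / (α * (1 + z) * z ^ (2 / α))) (Set.Ioi 0) := by
  have h := (integrableOn_rpow_neg_div_one_add (a := 2 / α) (by positivity)
    ((div_lt_one (by linarith)).2 hα)).const_mul (s ^ (2 / α) / α)
  exact IntegrableOn.congr_fun h (fun z hz => (laplace_integrand_eq hz).symm) measurableSet_Ioi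

lemma laplaceI₂_zero_radius {lam α s : ℝ} (hα : 2 < α) (hs : 0 < s) :
    laplaceI₂ lam 0 α s =
      Real.exp (-(2 * Real.pi ^ 2 * lam * s ^ (2 / α) / (α * Real.sin (2 * Real.pi / α)))) := by
  have hset : {z : ℝ | 0 < z ∧ ENNReal.ofReal z ≤ ENNReal.ofReal s / ENNReal.ofReal 0 ^ α} =
      Set.Ioi 0 := by
    ext z
    simp [ENNReal.zero_rpow_of_pos (show 0 < α by linarith), ENNReal.div_zero, hs]
  rw [laplaceI₂, hset, setIntegral_congr_fun measurableSet_Ioi fun z hz => laplace_integrand_eq hz,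
    integral_const_mul, integral_rpow_neg_div_one_add (by positivity)
    ((div_lt_one (by linarith)).2 hα)]
  congr 2
  rw [show Real.pi * (2 / α) = 2 * Real.pi / α by ring]
  field_simp

/-- The exponent of `laplaceI₂` as a radial integral outside of the guard zone. -/
lemma lintegral_radial_eq_laplace {rg α s : ℝ} (hrg : 0 ≤ rg) (hα : 2 < α) (hs : 0 < s) :
    ∫⁻ r in Set.Ioi (0 : ℝ), (Set.Ici rg).indicator
      (fun r => ENNReal.ofReal (r * (s * r ^ (-α) / (1 + s * r ^ (-α))))) r =
    ENNReal.ofReal (∫ z in laplaceRange rg α s, s ^ (2 / α) / (α * (1 + z) * z ^ (2 / α))) := by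
  have hα0 : 0 < α := by linarith
  set G : ℝ → ℝ := (laplaceRange rg α s).indicator
    fun z => s ^ (2 / α) / (α * (1 + z) * z ^ (2 / α)) with hG
  have hint : IntegrableOn G (Set.Ioi 0) :=
    (integrableOn_laplace_integrand hα).indicator (measurableSet_laplaceRange _ _ _)
  -- The substitution `z = s * r ^ (-α)` is split into a power map, with Jacobian `|-α| * r ^ (-α -
  -- 1)`, and a scaling, with Jacobian `s`.
  have hpt : ∀ r ∈ Set.Ioi (0 : ℝ), (|-α| * r ^ (-α - 1)) • (s * G (s * r ^ (-α))) =
      (Set.Ici rg).indicator (fun r => r * (s * r ^ (-α) / (1 + s * r ^ (-α)))) r := by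
    intro r hr
    have hr : 0 < r := hr
    by_cases h : rg ≤ r
    · rw [hG, Set.indicator_of_mem ((mem_laplaceRange hrg hα0 hs hr).2 h),
        Set.indicator_of_mem (Set.mem_Ici.2 h), abs_neg, abs_of_pos hα0, smul_eq_mul,
        Real.mul_rpow hs.le (by positivity), ← Real.rpow_mul hr.le,
        show -α * (2 / α) = -2 by field_simp, Real.rpow_sub hr, Real.rpow_one,
        Real.rpow_neg hr.le 2]
      have : 1 + s * r ^ (-α) ≠ 0 := by positivity
      have : s ^ (2 / α) ≠ 0 := by positivity
      norm_num
      field_simp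
    · rw [hG, Set.indicator_of_notMem (mt (mem_laplaceRange hrg hα0 hs hr).1 h),
        Set.indicator_of_notMem (by simpa using h), mul_zero, smul_zero]
  have hsub : ∫ z in Set.Ioi (0 : ℝ), s * G (s * z) = ∫ z in Set.Ioi (0 : ℝ), G z := by
    rw [integral_const_mul, integral_comp_mul_left_Ioi G 0 hs, mul_zero, smul_eq_mul,
      mul_inv_cancel_left₀ hs.ne']
  have hint' : IntegrableOn (fun z => s * G (s * z)) (Set.Ioi 0) := by
    refine Integrable.const_mul ?_ s
    have := (integrableOn_Ioi_comp_mul_left_iff G 0 hs).2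
    rw [mul_zero] at this
    exact this hint
  have hsub' := integral_comp_rpow_Ioi (fun z => s * G (s * z)) (neg_ne_zero.2 hα0.ne')
  have hint'' := (integrableOn_Ioi_comp_rpow_iff (fun z => s * G (s * z))
    (neg_ne_zero.2 hα0.ne')).2 hint'
  rw [setIntegral_congr_fun measurableSet_Ioi hpt, hsub, hG,
    setIntegral_indicator (measurableSet_laplaceRange _ _ _),
    Set.inter_eq_right.2 fun z hz => hz.1] at hsub'
  rw [← hsub', ofReal_integral_eq_lintegral_ofReal (hint''.congr_fun hpt measurableSet_Ioi)]
  · refine lintegral_congr fun r => ?_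
    by_cases h : r ∈ Set.Ici rg <;> simp [h]
  · refine (ae_restrict_iff' measurableSet_Ioi).2 (ae_of_all _ fun r hr => ?_)
    have hr : 0 < r := hr
    exact Set.indicator_nonneg (fun r hr' => by
      have : 0 ≤ r := hrg.trans hr'
      positivity) r

end Integrals

/-! ### Shot noise and the signal-to-interference ratio at a fixed location -/

/-- The interference at `y`, divided by the transmission power, caused by transmitters at the
points `X i` with marks `b i` and fading gains `g i` when those closer than `ρ` to `y` are
silent. -/
def shotNoise (α ρ : ℝ) (y : Plane) (X : ℕ → Plane) (b : ℕ → Bool) (g : ℕ → ℝ) : ℝ≥0∞ :=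
  ∑' i, if b i = true ∧ ρ ≤ dist (X i) y then ENNReal.ofReal (g i) * edist (X i) y ^ (-α) else 0

/-- The contribution of a single transmitter to the shot noise. -/
def thinned (α ρ : ℝ) (y x : Plane) (w : Bool × ℝ) : ℝ≥0∞ :=
  if w.1 = true ∧ ρ ≤ dist x y then ENNReal.ofReal w.2 * edist x y ^ (-α) else 0

lemma measurable_thinned (α ρ : ℝ) (y : Plane) :
    Measurable (Function.uncurry (thinned α ρ y)) := by
  refine Measurable.ite ?_ ?_ measurable_const
  · exact (measurable_snd.fst (measurableSet_singleton true)).inter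
      (measurableSet_le measurable_const (measurable_fst.dist measurable_const))
  · exact (ENNReal.measurable_ofReal.comp measurable_snd.snd).mul
      ((measurable_fst.edist measurable_const).pow_const _)

/-- The signal-to-interference ratio at `y` when the direct link has fading gain `h`. -/
def sirAt (p : Params) (y : Plane) (h : ℝ) (J : ℝ≥0∞) : ℝ≥0∞ :=
  Network.received p h p.x₁ y / (ENNReal.ofReal p.power * J)

lemma measurable_shotNoise {S : Type*} [MeasurableSpace S] {α ρ : ℝ} {y : S → Plane}
    {X : ℕ → S → Plane} {b : ℕ → S → Bool} {g : ℕ → S → ℝ} (hy : Measurable y)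
    (hX : ∀ i, Measurable (X i)) (hb : ∀ i, Measurable (b i)) (hg : ∀ i, Measurable (g i)) :
    Measurable fun w => shotNoise α ρ (y w) (fun i => X i w) (fun i => b i w) (fun i => g i w) := by
  refine Measurable.tsum fun i => Measurable.ite ?_ ?_ measurable_const
  · exact ((hb i) (measurableSet_singleton true)).inter
      (measurableSet_le measurable_const ((hX i).dist hy))
  · exact (ENNReal.measurable_ofReal.comp (hg i)).mul (((hX i).edist hy).pow_const _)

lemma measurable_sirAt {S : Type*} [MeasurableSpace S] (p : Params) {y : S → Plane}
    {h : S → ℝ} {J : S → ℝ≥0∞} (hy : Measurable y) (hh : Measurable h) (hJ : Measurable J) :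
    Measurable fun w => sirAt p (y w) (h w) (J w) :=
  (((measurable_const.mul (ENNReal.measurable_ofReal.comp hh)).mul
    ((measurable_const.edist hy).pow_const _))).div (measurable_const.mul hJ)

lemma sirAt_eq {p : Params} {y : Plane} (hy : y ≠ p.x₁) (h : ℝ) (J : ℝ≥0∞) :
    sirAt p y h J = ENNReal.ofReal h / ENNReal.ofReal (dist p.x₁ y ^ p.alpha) / J := by
  have hd : 0 < dist p.x₁ y := dist_pos.2 hy.symm
  rw [sirAt, Network.received, mul_assoc, ENNReal.mul_div_mul_left _ _
    (ENNReal.ofReal_pos.2 p.power_pos).ne' ENNReal.ofReal_ne_top, edist_dist,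
    ENNReal.ofReal_rpow_of_pos hd, Real.rpow_neg hd.le, ENNReal.ofReal_inv_of_pos (by positivity),
    ← div_eq_mul_inv]

lemma lt_sirAt_iff {p : Params} {y : Plane} (hy : y ≠ p.x₁) {β : ℝ} (hβ : 0 < β) (h : ℝ)
    (J : ℝ≥0∞) :
    ENNReal.ofReal β < sirAt p y h J ↔
      ENNReal.ofReal (β * dist p.x₁ y ^ p.alpha) * J < ENNReal.ofReal h := by
  have hd : 0 < dist p.x₁ y := dist_pos.2 hy.symm
  have hD : 0 < dist p.x₁ y ^ p.alpha := by positivity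
  rw [sirAt_eq hy, ENNReal.lt_div_iff_mul_lt, ENNReal.lt_div_iff_mul_lt, ENNReal.ofReal_mul hβ.le,
    mul_right_comm]
  · left; simpa using hD
  · left; simp
  · right; simp
  · right; simpa using hβ

/-- Unlike the strict version this needs `0 < h`: if `h ≤ 0` and `J = 0`, the ratio is `0 / 0 = 0`,
below `β`, while the right-hand side reads `0 ≤ 0`. -/
lemma le_sirAt_iff {p : Params} {y : Plane} (hy : y ≠ p.x₁) {β h : ℝ} (hβ : 0 < β) (hh : 0 < h)
    (J : ℝ≥0∞) :
    ENNReal.ofReal β ≤ sirAt p y h J ↔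
      ENNReal.ofReal (β * dist p.x₁ y ^ p.alpha) * J ≤ ENNReal.ofReal h := by
  have hd : 0 < dist p.x₁ y := dist_pos.2 hy.symm
  have hD : 0 < dist p.x₁ y ^ p.alpha := by positivity
  rw [sirAt_eq hy, ENNReal.le_div_iff_mul_le, ENNReal.le_div_iff_mul_le, ENNReal.ofReal_mul hβ.le,
    mul_right_comm]
  · left; simpa using hD
  · left; simp
  · right; simp [hh]
  · right; simp [ENNReal.div_eq_top, hD]

lemma sigmaFinite_ofReal_smul_volume (l : ℝ) :
    SigmaFinite (ENNReal.ofReal l • (volume : Measure Plane)) :=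
  inferInstanceAs (SigmaFinite (l.toNNReal • (volume : Measure Plane)))

lemma smul_volume_ball {l r : ℝ} (hl : 0 ≤ l) (hr : 0 ≤ r) (x : Plane) :
    (ENNReal.ofReal l • (volume : Measure Plane)) (Metric.ball x r) =
      ENNReal.ofReal (l * Real.pi * r ^ 2) := by
  rw [Measure.smul_apply, EuclideanSpace.volume_ball_fin_two, smul_eq_mul,
    ← ENNReal.ofReal_pow hr, ← ENNReal.ofReal_mul' Real.pi_pos.le, ← ENNReal.ofReal_mul hl]
  congr 1
  ring

/-- The conditional mean of `exp (-s J)`, where `J` is the shot noise at `y` of a single transmitter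
at `x` that is active with probability `P`. -/
def retention (P α ρ s : ℝ) (y x : Plane) : ℝ≥0∞ :=
  if ρ ≤ dist x y then
    ENNReal.ofReal P * (1 + ENNReal.ofReal s * edist x y ^ (-α))⁻¹ + (1 - ENNReal.ofReal P)
  else 1

/-- With `c = s * dist x y ^ (-α)` this is `P * (1 - 1 / (1 + c)) = P * (c / (1 + c))` outside the
guard zone. -/
lemma one_sub_retention {P α ρ s : ℝ} (hP0 : 0 ≤ P) (hP1 : P ≤ 1) (hs : 0 < s)
    {x y : Plane} (hx : x ≠ y) :
    1 - retention P α ρ s y x = ENNReal.ofReal P * (Set.Ici ρ).indicator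
      (fun r => ENNReal.ofReal (s * r ^ (-α) / (1 + s * r ^ (-α)))) ‖x - y‖ := by
  have hd : 0 < dist x y := dist_pos.2 hx
  rw [← dist_eq_norm, retention]
  by_cases h : ρ ≤ dist x y
  · rw [if_pos h, Set.indicator_of_mem (Set.mem_Ici.2 h), edist_dist,
      ENNReal.ofReal_rpow_of_pos hd, ← ENNReal.ofReal_mul hs.le]
    have hc : 0 < s * dist x y ^ (-α) := by positivity
    generalize s * dist x y ^ (-α) = c at hc
    have hc1 : (1 + c)⁻¹ ≤ 1 := inv_le_one_of_one_le₀ (by linarith)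
    have hc0 : 0 ≤ P * (1 + c)⁻¹ := mul_nonneg hP0 (by positivity)
    rw [← ENNReal.ofReal_one, ← ENNReal.ofReal_add one_pos.le hc.le,
      ← ENNReal.ofReal_inv_of_pos (by positivity), ← ENNReal.ofReal_mul hP0,
      ← ENNReal.ofReal_sub _ hP0, ← ENNReal.ofReal_add hc0 (by linarith),
      ← ENNReal.ofReal_sub _ (by linarith), ← ENNReal.ofReal_mul hP0]
    congr 1
    field_simp
    ring
  · rw [if_neg h, Set.indicator_of_notMem (by simpa using h)]
    simp

lemma laplace_exponent_nonneg {α ρ s : ℝ} (hα : 0 < α) (hs : 0 < s) :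
    0 ≤ ∫ z in laplaceRange ρ α s, s ^ (2 / α) / (α * (1 + z) * z ^ (2 / α)) :=
  setIntegral_nonneg (measurableSet_laplaceRange _ _ _) fun z hz => by
    have := hz.1
    positivity

/-- Translation invariance moves `y` to the origin, and polar coordinates reduce the integral to
`lintegral_radial_eq_laplace`. -/
lemma expNeg_lintegral_one_sub_retention {l P α ρ s : ℝ} (hl : 0 ≤ l) (hP0 : 0 ≤ P) (hP1 : P ≤ 1)
    (hα : 2 < α) (hρ : 0 ≤ ρ) (hs : 0 < s) (y : Plane) :
    expNeg (∫⁻ x, (1 - retention P α ρ s y x) ∂(ENNReal.ofReal l • (volume : Measure Plane))) =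
      ENNReal.ofReal (laplaceI₂ (l * P) ρ α s) := by
  set φ : ℝ → ℝ≥0∞ := (Set.Ici ρ).indicator
    fun r => ENNReal.ofReal (s * r ^ (-α) / (1 + s * r ^ (-α))) with hφd
  have hφ : Measurable φ := by
    refine Measurable.indicator ?_ measurableSet_Ici
    fun_prop
  have h0 : ∀ᵐ x : Plane, x ≠ y := by simp [ae_iff]
  have h1 : ∀ᵐ x : Plane, 1 - retention P α ρ s y x = ENNReal.ofReal P * φ ‖x - y‖ :=
    h0.mono fun x hx => one_sub_retention hP0 hP1 hs hx
  have h2 : ∀ r ∈ Set.Ioi (0 : ℝ), ENNReal.ofReal r * φ r = (Set.Ici ρ).indicator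
      (fun r => ENNReal.ofReal (r * (s * r ^ (-α) / (1 + s * r ^ (-α))))) r := by
    intro r hr
    by_cases h : ρ ≤ r
    · rw [hφd, Set.indicator_of_mem (Set.mem_Ici.2 h), Set.indicator_of_mem (Set.mem_Ici.2 h),
        ENNReal.ofReal_mul (le_of_lt hr)]
    · rw [hφd, Set.indicator_of_notMem (by simpa using h), Set.indicator_of_notMem
        (by simpa using h), mul_zero]
  have hI := laplace_exponent_nonneg (ρ := ρ) (two_pos.trans hα) hs
  rw [lintegral_smul_measure, lintegral_congr_ae h1, lintegral_const_mul
    (f := fun x : Plane => φ ‖x - y‖) _ (hφ.comp (measurable_id.sub_const y).norm),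
    lintegral_sub_right_eq_self (fun x => φ ‖x‖) y, lintegral_fun_norm hφ,
    setLIntegral_congr_fun measurableSet_Ioi h2, lintegral_radial_eq_laplace hρ hα hs, smul_eq_mul,
    ← ENNReal.ofReal_mul (by positivity), ← ENNReal.ofReal_mul hP0, ← ENNReal.ofReal_mul hl,
    expNeg_ofReal (by positivity), laplaceI₂, ← laplaceRange]
  congr 3
  ring

/-! ### Independence of the sources and the interference at a receiver -/

namespace Network

variable {Ω : Type*} [MeasurableSpace Ω] {N : Network Ω} {p : Params} {μ : Measure Ω}

/-- The information generated by a set of sources of randomness. -/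
@[reducible] def infoOf {Ω : Type*} (N : Network Ω) (S : Set Source) : MeasurableSpace Ω :=
  ⨆ s ∈ S, N.info s

lemma info_le_infoOf {Ω : Type*} (N : Network Ω) {S : Set Source} {s : Source} (hs : s ∈ S) :
    N.info s ≤ N.infoOf S :=
  le_iSup₂ (f := fun s (_ : s ∈ S) => N.info s) s hs

lemma IsModel.info_le (hN : N.IsModel p μ) (s : Source) : N.info s ≤ ‹MeasurableSpace Ω› := by
  cases s with
  | er => exact iSup_le fun j => (hN.er_poisson.measurable j).comap_le
  | pt k => exact iSup_le fun i => ((hN.pt_poisson k).measurable i).comap_le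
  | mark k i => exact (hN.mark_measurable k i).comap_le
  | direct k => exact (hN.direct_measurable k).comap_le
  | cross k i => exact (hN.cross_measurable k i).comap_le

lemma IsModel.infoOf_le (hN : N.IsModel p μ) (S : Set Source) :
    N.infoOf S ≤ ‹MeasurableSpace Ω› :=
  iSup₂_le fun s _ => hN.info_le s

lemma IsModel.indep_infoOf (hN : N.IsModel p μ) {S T : Set Source} (h : Disjoint S T) :
    Indep (N.infoOf S) (N.infoOf T) μ :=
  indep_iSup_of_disjoint hN.info_le hN.independent h

lemma measurable_er {Ω : Type*} (N : Network Ω) {S : Set Source} (h : .er ∈ S) (j : ℕ) :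
    Measurable[N.infoOf S] (N.er j) :=
  Measurable.of_comap_le ((le_iSup (fun j => MeasurableSpace.comap (N.er j) inferInstance) j).trans
    (N.info_le_infoOf h))

lemma measurable_pt {Ω : Type*} (N : Network Ω) {S : Set Source} {k : Option ℕ} (h : .pt k ∈ S)
    (i : ℕ) : Measurable[N.infoOf S] (N.pt k i) :=
  Measurable.of_comap_le
    ((le_iSup (fun i => MeasurableSpace.comap (N.pt k i) inferInstance) i).trans
      (N.info_le_infoOf h))

lemma measurable_mark {Ω : Type*} (N : Network Ω) {S : Set Source} {k : Option ℕ} {i : ℕ}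
    (h : .mark k i ∈ S) : Measurable[N.infoOf S] (N.mark k i) :=
  Measurable.of_comap_le (N.info_le_infoOf h)

lemma measurable_direct {Ω : Type*} (N : Network Ω) {S : Set Source} {k : Option ℕ}
    (h : .direct k ∈ S) : Measurable[N.infoOf S] (N.direct k) :=
  Measurable.of_comap_le (N.info_le_infoOf h)

lemma measurable_cross {Ω : Type*} (N : Network Ω) {S : Set Source} {k : Option ℕ} {i : ℕ}
    (h : .cross k i ∈ S) : Measurable[N.infoOf S] (N.cross k i) :=
  Measurable.of_comap_le (N.info_le_infoOf h)

lemma pActive_nonneg : 0 ≤ N.pActive p μ := measureReal_nonneg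

lemma IsModel.lintegral_mark_cross [IsProbabilityMeasure μ] (hN : N.IsModel p μ) (k : Option ℕ)
    (i : ℕ) (c : ℝ≥0∞) :
    ∫⁻ ω, expNeg (if N.mark k i ω = true then c * ENNReal.ofReal (N.cross k i ω) else 0) ∂μ =
      ENNReal.ofReal (N.pActive p μ) * (1 + c)⁻¹ + (1 - ENNReal.ofReal (N.pActive p μ)) := by
  set A : Set Ω := {ω | N.mark k i ω = true} with hA
  have hAm : MeasurableSet A := hN.mark_measurable k i (measurableSet_singleton true)
  have hμA : μ A = ENNReal.ofReal (N.pActive p μ) := by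
    rw [← hN.mark_law k i, ofReal_measureReal]
  have hg : Measurable fun x => expNeg (c * ENNReal.ofReal x) :=
    measurable_expNeg.comp (measurable_const.mul ENNReal.measurable_ofReal)
  have hsplit : ∀ ω, expNeg (if N.mark k i ω = true then c * ENNReal.ofReal (N.cross k i ω) else 0)
      = A.indicator 1 ω * expNeg (c * ENNReal.ofReal (N.cross k i ω)) + Aᶜ.indicator 1 ω := by
    intro ω
    by_cases h : N.mark k i ω = true
    · have hω : ω ∈ A := h
      simp [h, hω]
    · have hω : ω ∉ A := h
      simp [h, hω]
  simp_rw [hsplit]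
  have hI : Measurable[N.infoOf {.mark k i}] (A.indicator (1 : Ω → ℝ≥0∞)) := by
    have : A.indicator (1 : Ω → ℝ≥0∞) = (fun b : Bool => if b = true then 1 else 0) ∘ N.mark k i := by
      ext ω
      simp [Set.indicator, hA]
    rw [this]
    exact (Measurable.of_discrete (f := fun b : Bool => if b = true then (1 : ℝ≥0∞) else 0)).comp
      (N.measurable_mark (by simp))
  have hind : Indep (N.infoOf {.mark k i}) (N.infoOf {.cross k i}) μ :=
    hN.indep_infoOf (by simp)
  rw [lintegral_add_right _ (measurable_one.indicator hAm.compl), lintegral_indicator_one hAm.compl,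
    prob_compl_eq_one_sub hAm, hμA,
    lintegral_mul_eq_lintegral_mul_lintegral_of_independent_measurableSpace
      (hN.infoOf_le _) (hN.infoOf_le _) hind
      hI
      (g := fun ω => expNeg (c * ENNReal.ofReal (N.cross k i ω)))
      (hg.comp (N.measurable_cross (by simp))),
    lintegral_indicator_one hAm, hμA]
  congr 2
  rw [← lintegral_expNeg_expMeasure, ← hN.cross_law k i, lintegral_map hg (hN.cross_measurable k i)]

lemma IsModel.indep_interferers (hN : N.IsModel p μ) (k : Option ℕ) (n : ℕ) :
    Indep (N.infoOf {.pt k} ⊔ ⨆ i ∈ Finset.range n, N.infoOf {.mark k i, .cross k i})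
      (N.infoOf {.mark k n, .cross k n}) μ := by
  refine indep_of_indep_of_le_left (hN.indep_infoOf
    (S := {.pt k} ∪ ⋃ i ∈ Finset.range n, {.mark k i, .cross k i}) ?_) ?_
  · rw [Set.disjoint_left]
    rintro s hs hs'
    simp only [Set.mem_union, Set.mem_singleton_iff, Set.mem_iUnion, Finset.mem_range,
      Set.mem_insert_iff, exists_prop] at hs hs'
    rcases hs' with rfl | rfl <;> simp at hs
  · exact sup_le (biSup_mono fun s hs => Or.inl hs) (iSup₂_le fun i hi =>
      biSup_mono fun s hs => Or.inr (Set.mem_biUnion hi hs))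

/-- The Laplace transform of the interference at a fixed location. -/
theorem IsModel.lintegral_expNeg_shotNoise [IsProbabilityMeasure μ] (hN : N.IsModel p μ)
    (k : Option ℕ) (y : Plane) {ρ s : ℝ} (hρ : 0 ≤ ρ) (hs : 0 < s) :
    ∫⁻ ω, expNeg (ENNReal.ofReal s * shotNoise p.alpha ρ y (fun i => N.pt k i ω)
        (fun i => N.mark k i ω) (fun i => N.cross k i ω)) ∂μ =
      ENNReal.ofReal (laplaceI₂ (p.lamP * N.pActive p μ) ρ p.alpha s) := by
  -- `retention` is the averaged factor `q` of an interferer marked by its activity and gain.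
  have hq : ∀ i x, ∫⁻ ω, expNeg (ENNReal.ofReal s * thinned p.alpha ρ y x
      (N.mark k i ω, N.cross k i ω)) ∂μ = retention (N.pActive p μ) p.alpha ρ s y x := by
    intro i x
    by_cases h : ρ ≤ dist x y
    · simp only [thinned, retention, h, and_true, if_true]
      rw [← hN.lintegral_mark_cross k i]
      refine lintegral_congr fun ω => ?_
      split_ifs
      · rw [mul_assoc, mul_comm (ENNReal.ofReal (N.cross k i ω))]
      · rw [mul_zero]
    · simp [thinned, retention, h]
  have := sigmaFinite_ofReal_smul_volume p.lamP
  have hW : ∀ i, Measurable[N.infoOf {.mark k i, .cross k i}]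
      (fun ω => (N.mark k i ω, N.cross k i ω)) := fun i =>
    Measurable.prodMk (N.measurable_mark (Set.mem_insert _ _))
      (N.measurable_cross (Set.mem_insert_of_mem _ rfl))
  have hX : ∀ i, Measurable[N.infoOf {.pt k}] (N.pt k i) :=
    N.measurable_pt (Set.mem_singleton _)
  have key := (hN.pt_poisson k).lintegral_marked (m := N.infoOf {.pt k})
    (m' := fun i => N.infoOf {.mark k i, .cross k i})
    (W := fun i ω => (N.mark k i ω, N.cross k i ω))
    (f := fun x w => expNeg (ENNReal.ofReal s * thinned p.alpha ρ y x w))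
    (Z := fun ω => expNeg (∑' i, ENNReal.ofReal s * thinned p.alpha ρ y (N.pt k i ω)
      (N.mark k i ω, N.cross k i ω)))
    (hN.infoOf_le _) (fun i => hN.infoOf_le _) (hN.indep_interferers k)
    hX
    hW
    (measurable_expNeg.comp (measurable_const.mul (measurable_thinned p.alpha ρ y)))
    (fun x w => expNeg_le_one _) hq (fun ω => tendsto_prod_expNeg _)
  rw [expNeg_lintegral_one_sub_retention p.lamP_pos.le pActive_nonneg measureReal_le_one
    p.two_lt_alpha hρ hs] at key
  rw [← key]
  refine lintegral_congr fun ω => ?_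
  rw [shotNoise, ← ENNReal.tsum_mul_left]
  rfl

end Network

/-! ### Void probabilities, receiver states and the connection probability -/

/-- The void probabilities of a Poisson process. -/
theorem IsPoissonProcess.measure_forall_notMem {Ω E : Type*} [MeasurableSpace Ω]
    [MeasurableSpace E] {X : ℕ → Ω → E} {ν : Measure E} [SigmaFinite ν] {μ : Measure Ω}
    [IsProbabilityMeasure μ] (hX : IsPoissonProcess X ν μ) {B : Set E} (hB : MeasurableSet B) :
    μ {ω | ∀ i, X i ω ∉ B} = expNeg (ν B) := by
  have hmeas : MeasurableSet {ω | ∀ i, X i ω ∉ B} := by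
    rw [Set.ofPred_forall]
    exact MeasurableSet.iInter fun i => hX.measurable i hB.compl
  -- With weight `∞` on `B`, a single point in `B` makes the exponential vanish, so the Laplace
  -- functional is the void probability.
  have h := hX.lintegral_expNeg_tsum (g := B.indicator fun _ => ∞) (measurable_const.indicator hB)
  have h1 : ∀ x, 1 - expNeg (B.indicator (fun _ => ∞) x) = B.indicator 1 x := fun x => by
    by_cases hx : x ∈ B <;> simp [hx]
  have h2 : ∀ ω, expNeg (∑' i, B.indicator (fun _ => ∞) (X i ω)) =
      {ω | ∀ i, X i ω ∉ B}.indicator 1 ω := fun ω => by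
    by_cases hω : ∀ i, X i ω ∉ B
    · rw [Set.indicator_of_mem (show ω ∈ {ω | ∀ i, X i ω ∉ B} from hω)]
      simp [hω]
    · rw [Set.indicator_of_notMem (show ω ∉ {ω | ∀ i, X i ω ∉ B} from hω)]
      push Not at hω
      obtain ⟨i, hi⟩ := hω
      rw [ENNReal.tsum_eq_top_of_eq_top ⟨i, by simp [hi]⟩, expNeg_top]
  simp_rw [h1, h2] at h
  rwa [lintegral_indicator_one hmeas, lintegral_indicator_one hB] at h

lemma tendsto_prod_ite (P : ℕ → Prop) [∀ i, Decidable (P i)] [Decidable (∀ i, P i)] :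
    Tendsto (fun n => ∏ i ∈ Finset.range n, if P i then (1 : ℝ≥0∞) else 0) atTop
      (𝓝 (if ∀ i, P i then 1 else 0)) := by
  by_cases h : ∀ i, P i
  · simp [h]
  · rw [if_neg h]
    push Not at h
    obtain ⟨i, hi⟩ := h
    refine tendsto_const_nhds.congr' ?_
    filter_upwards [eventually_gt_atTop i] with n hn
    exact (Finset.prod_eq_zero (Finset.mem_range.2 hn) (if_neg hi)).symm

/-- The random elements attached to a receiver: interfering transmitters, their marks, the direct
gain and the cross gains. -/
abbrev State : Type := (ℕ → Plane) × (ℕ → Bool) × ℝ × (ℕ → ℝ)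

/-- The signal-to-interference ratio of a receiver at `y` in a given state. -/
def sir (p : Params) (ρ : ℝ) (y : Plane) (w : State) : ℝ≥0∞ :=
  sirAt p y w.2.2.1 (shotNoise p.alpha ρ y w.1 w.2.1 w.2.2.2)

lemma measurable_sir (p : Params) (ρ : ℝ) : Measurable (Function.uncurry (sir p ρ)) :=
  measurable_sirAt p measurable_fst measurable_snd.snd.snd.fst
    (measurable_shotNoise measurable_fst
      (fun i => (measurable_pi_apply i).comp measurable_snd.fst)
      (fun i => (measurable_pi_apply i).comp measurable_snd.snd.fst)
      (fun i => (measurable_pi_apply i).comp measurable_snd.snd.snd.snd))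

namespace Network

/-- The state of receiver `k`. -/
def state {Ω : Type*} (N : Network Ω) (k : Option ℕ) (ω : Ω) : State :=
  (fun i => N.pt k i ω, fun i => N.mark k i ω, N.direct k ω, fun i => N.cross k i ω)

/-- The sources of the interference at receiver `k`. -/
def interfererSources (k : Option ℕ) : Set Source :=
  {s | s = .pt k ∨ ∃ i, s = .mark k i ∨ s = .cross k i}

/-- The sources of randomness attached to receiver `k`. -/
def receiverSources (k : Option ℕ) : Set Source :=
  {s | s = .direct k ∨ s ∈ interfererSources k}

lemma measurable_interferers {Ω : Type*} (N : Network Ω) (k : Option ℕ) {S : Set Source}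
    (hS : interfererSources k ⊆ S) :
    Measurable[N.infoOf S] fun ω => ((fun i => N.pt k i ω, fun i => N.mark k i ω,
      fun i => N.cross k i ω) : (ℕ → Plane) × (ℕ → Bool) × (ℕ → ℝ)) := by
  have h1 : ∀ i, Measurable[N.infoOf S] (N.pt k i) := N.measurable_pt (hS (Or.inl rfl))
  have h2 : ∀ i, Measurable[N.infoOf S] (N.mark k i) := fun i =>
    N.measurable_mark (hS (Or.inr ⟨i, Or.inl rfl⟩))
  have h3 : ∀ i, Measurable[N.infoOf S] (N.cross k i) := fun i =>
    N.measurable_cross (hS (Or.inr ⟨i, Or.inr rfl⟩))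
  let : MeasurableSpace Ω := N.infoOf S
  exact Measurable.prodMk (measurable_pi_iff.2 h1)
    (Measurable.prodMk (measurable_pi_iff.2 h2) (measurable_pi_iff.2 h3))

lemma measurable_state {Ω : Type*} (N : Network Ω) (k : Option ℕ) :
    Measurable[N.infoOf (receiverSources k)] (N.state k) := by
  have h := N.measurable_interferers k (S := receiverSources k) fun s hs => Or.inr hs
  have h4 : Measurable[N.infoOf (receiverSources k)] (N.direct k) :=
    N.measurable_direct (Or.inl rfl)
  have hg : Measurable fun z : ℝ × ((ℕ → Plane) × (ℕ → Bool) × (ℕ → ℝ)) =>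
      ((z.2.1, z.2.2.1, z.1, z.2.2.2) : State) := by fun_prop
  exact hg.comp (Measurable.prodMk h4 h)

variable {Ω : Type*} {N : Network Ω} {p : Params}

/-- The PR silences no interferer; guard radius `0` expresses this, since distances are nonnegative.
-/
lemma sinr_eq_sir (hPR : p.noisePR = 0) (ω : Ω) :
    N.sinr p none ω = sir p 0 0 (N.state none ω) := by
  have : N.interference p none ω = ENNReal.ofReal p.power * shotNoise p.alpha 0 0
      (fun i => N.pt none i ω) (fun i => N.mark none i ω) (fun i => N.cross none i ω) := by
    rw [interference, shotNoise, ← ENNReal.tsum_mul_left]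
    refine tsum_congr fun i => ?_
    by_cases h : N.mark none i ω = true <;>
      simp [active, h, received, loc, mul_assoc]
  rw [sinr, this, noise, hPR]
  simp [sir, sirAt, state, loc]

lemma sinr_eq_sir_some (hER : p.noiseER = 0) (j : ℕ) (ω : Ω) :
    N.sinr p (some j) ω = sir p p.rg (N.er j ω) (N.state (some j) ω) := by
  have : N.interference p (some j) ω = ENNReal.ofReal p.power * shotNoise p.alpha p.rg (N.er j ω)
      (fun i => N.pt (some j) i ω) (fun i => N.mark (some j) i ω)
      (fun i => N.cross (some j) i ω) := by
    rw [interference, shotNoise, ← ENNReal.tsum_mul_left]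
    refine tsum_congr fun i => ?_
    by_cases h : N.mark (some j) i ω = true ∧ p.rg ≤ dist (N.pt (some j) i ω) (N.er j ω)
    · rw [if_pos h, Set.indicator_of_mem (show ω ∈ N.active p (some j) i from h), received,
        mul_assoc]
      rfl
    · rw [if_neg h, Set.indicator_of_notMem (show ω ∉ N.active p (some j) i from h), mul_zero]
  rw [sinr, this, noise, hER]
  simp [sir, sirAt, state, loc]

lemma clear_eq : N.clear p = {ω | ∀ j, N.er j ω ∉ Metric.ball p.x₁ p.rg} := by
  ext ω
  simp only [clear, nearestER, Set.mem_ofPred_eq, le_iInf_iff, edist_dist, Metric.mem_ball, not_lt,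
    dist_comm p.x₁]
  exact forall_congr' fun j => ENNReal.ofReal_le_ofReal_iff dist_nonneg

variable [MeasurableSpace Ω] {μ : Measure Ω}

/-- Given the interference, the direct gain is still exponential, so its tail at `T` is `expNeg (T
ω)`. A general set `A` serves both the strict comparison (ERs) and the weak one (PR). -/
lemma IsModel.measure_direct_mem [IsProbabilityMeasure μ] (hN : N.IsModel p μ) (k : Option ℕ)
    {T : Ω → ℝ≥0∞} (hT : Measurable[N.infoOf (interfererSources k)] T) {A : Set (ℝ≥0∞ × ℝ)}
    (hA : MeasurableSet A) (h : ∀ t, expMeasure 1 {x | (t, x) ∈ A} = expNeg t) :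
    μ {ω | (T ω, N.direct k ω) ∈ A} = ∫⁻ ω, expNeg (T ω) ∂μ := by
  have hind : Indep (N.infoOf (interfererSources k)) (N.infoOf {.direct k}) μ :=
    hN.indep_infoOf (by simp [interfererSources])
  have hd : Measurable[N.infoOf {.direct k}] (N.direct k) :=
    N.measurable_direct (Set.mem_singleton _)
  have hT' : Measurable T := hT.mono (hN.infoOf_le _) le_rfl
  have hd' := hN.direct_measurable k
  have hF := lintegral_comp_of_indep (hN.infoOf_le _) (hN.infoOf_le _) hind hT hd
    (F := fun t x => A.indicator 1 (t, x)) (measurable_one.indicator hA)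
  rw [← lintegral_indicator_one (show MeasurableSet {ω | (T ω, N.direct k ω) ∈ A} from
    (hT'.prodMk hd') hA)]
  refine Eq.trans (by rfl) (hF.trans (lintegral_congr fun ω => ?_))
  have hA' : MeasurableSet {x : ℝ | (T ω, x) ∈ A} := measurable_prodMk_left hA
  rw [← h, ← hN.direct_law k, Measure.map_apply hd' hA', ← lintegral_indicator_one (hd' hA')]
  rfl

lemma measurable_mul_shotNoise {Ω : Type*} (N : Network Ω) (k : Option ℕ) (α ρ s : ℝ)
    (y : Plane) :
    Measurable[N.infoOf (interfererSources k)] fun ω => ENNReal.ofReal s *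
      shotNoise α ρ y (fun i => N.pt k i ω) (fun i => N.mark k i ω) (fun i => N.cross k i ω) := by
  have h : Measurable fun w : (ℕ → Plane) × (ℕ → Bool) × (ℕ → ℝ) =>
      ENNReal.ofReal s * shotNoise α ρ y (fun i => w.1 i) (fun i => w.2.1 i) (fun i => w.2.2 i) :=
    measurable_const.mul (measurable_shotNoise measurable_const
      (fun i => (measurable_pi_apply i).comp measurable_fst)
      (fun i => (measurable_pi_apply i).comp measurable_snd.fst)
      (fun i => (measurable_pi_apply i).comp measurable_snd.snd))
  exact h.comp (N.measurable_interferers k subset_rfl)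

lemma IsModel.measure_lt_sir [IsProbabilityMeasure μ] (hN : N.IsModel p μ) (k : Option ℕ)
    {y : Plane} (hy : y ≠ p.x₁) {ρ β : ℝ} (hρ : 0 ≤ ρ) (hβ : 0 < β) :
    μ {ω | ENNReal.ofReal β < sir p ρ y (N.state k ω)} =
      ENNReal.ofReal (laplaceI₂ (p.lamP * N.pActive p μ) ρ p.alpha
        (β * dist p.x₁ y ^ p.alpha)) := by
  have hd : 0 < dist p.x₁ y := dist_pos.2 hy.symm
  rw [← hN.lintegral_expNeg_shotNoise k y hρ (by positivity),
    ← hN.measure_direct_mem k (N.measurable_mul_shotNoise k _ _ _ _)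
      (measurableSet_lt measurable_fst (ENNReal.measurable_ofReal.comp measurable_snd))
      expMeasure_ofReal_gt]
  congr 1
  ext ω
  exact lt_sirAt_iff hy hβ _ _

lemma IsModel.measure_le_sir [IsProbabilityMeasure μ] (hN : N.IsModel p μ) (k : Option ℕ)
    {y : Plane} (hy : y ≠ p.x₁) {ρ β : ℝ} (hρ : 0 ≤ ρ) (hβ : 0 < β) :
    μ {ω | ENNReal.ofReal β ≤ sir p ρ y (N.state k ω)} =
      ENNReal.ofReal (laplaceI₂ (p.lamP * N.pActive p μ) ρ p.alpha
        (β * dist p.x₁ y ^ p.alpha)) := by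
  have hd : 0 < dist p.x₁ y := dist_pos.2 hy.symm
  rw [← hN.lintegral_expNeg_shotNoise k y hρ (by positivity),
    ← hN.measure_direct_mem k (N.measurable_mul_shotNoise k _ _ _ _)
      (measurableSet_le measurable_fst (ENNReal.measurable_ofReal.comp measurable_snd))
      expMeasure_ofReal_ge]
  refine measure_congr ?_
  have hpos : ∀ᵐ ω ∂μ, 0 < N.direct k ω := by
    have := ae_pos_expMeasure
    rw [← hN.direct_law k] at this
    exact ae_of_ae_map (hN.direct_measurable k).aemeasurable this
  filter_upwards [hpos] with ω hω
  exact propext (le_sirAt_iff hy hβ hω _)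

lemma measurableSet_clear {Ω : Type*} (N : Network Ω) (p : Params) :
    MeasurableSet[N.infoOf {.er}] (N.clear p) := by
  rw [clear_eq, Set.ofPred_forall]
  have h : ∀ j, Measurable[N.infoOf {.er}] (N.er j) := N.measurable_er (Set.mem_singleton _)
  exact MeasurableSet.iInter fun j => h j Metric.isOpen_ball.measurableSet.compl

theorem IsModel.measure_clear [IsProbabilityMeasure μ] (hN : N.IsModel p μ) :
    μ (N.clear p) = ENNReal.ofReal (Real.exp (-(p.lamS * Real.pi * p.rg ^ 2))) := by
  have := sigmaFinite_ofReal_smul_volume p.lamS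
  have := p.lamS_pos
  rw [clear_eq, hN.er_poisson.measure_forall_notMem Metric.isOpen_ball.measurableSet,
    smul_volume_ball p.lamS_pos.le p.rg_nonneg, expNeg_ofReal (by positivity)]

theorem IsModel.pActive_eq [IsProbabilityMeasure μ] (hN : N.IsModel p μ) :
    N.pActive p μ = Real.exp (-(p.lamS * Real.pi * p.rg ^ 2)) := by
  rw [pActive, measureReal_def, hN.measure_clear, ENNReal.toReal_ofReal (Real.exp_pos _).le]

theorem IsModel.pCon_eq [IsProbabilityMeasure μ] (hN : N.IsModel p μ) (hPR : p.noisePR = 0)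
    {β : ℝ} (hβ : 0 < β) :
    N.pCon p μ β = Real.exp (-(p.lamS * Real.pi * p.rg ^ 2 +
        2 * Real.pi ^ 2 * p.lamP * N.pActive p μ * β ^ (2 / p.alpha) * p.r₁ ^ 2 /
          (p.alpha * Real.sin (2 * Real.pi / p.alpha)))) := by
  have hα : 0 < p.alpha := two_pos.trans p.two_lt_alpha
  have hr : 0 < p.r₁ := norm_pos_iff.2 p.x₁_ne_zero
  -- The guard event uses only the ER locations and the ratio at the PR only the PR's own sources,
  -- so the probability factors.
  have hind : Indep (N.infoOf {.er}) (N.infoOf (receiverSources none)) μ :=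
    hN.indep_infoOf (by simp [receiverSources, interfererSources])
  have hB : MeasurableSet[N.infoOf (receiverSources none)]
      {ω | ENNReal.ofReal β ≤ sir p 0 0 (N.state none ω)} :=
    N.measurable_state none (measurableSet_le measurable_const
      ((measurable_sir p 0).comp measurable_prodMk_left))
  have hset : {ω | ω ∈ N.clear p ∧ ENNReal.ofReal β ≤ N.sinr p none ω} =
      N.clear p ∩ {ω | ENNReal.ofReal β ≤ sir p 0 0 (N.state none ω)} := by
    ext ω
    simp [sinr_eq_sir hPR]
  rw [pCon, hset, measureReal_def, (Indep_iff _ _ _).1 hind _ _ (N.measurableSet_clear p) hB,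
    hN.measure_clear, hN.measure_le_sir none p.x₁_ne_zero.symm le_rfl hβ, dist_zero_right,
    ← ENNReal.ofReal_mul (Real.exp_pos _).le, laplaceI₂_zero_radius p.two_lt_alpha
    (by rw [← Params.r₁]; positivity), ← Real.exp_add, ENNReal.toReal_ofReal (Real.exp_pos _).le,
    ← Params.r₁, Real.mul_rpow hβ.le (by positivity), ← Real.rpow_mul hr.le,
    mul_div_cancel₀ _ hα.ne', Real.rpow_two, neg_add]
  congr 3
  ring

end Network

/-! ### Convergence of the radial integral -/

lemma laplaceI₂_pos (lam ρ α s : ℝ) : 0 < laplaceI₂ lam ρ α s := Real.exp_pos _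

lemma laplaceI₂_le_one {lam ρ α s : ℝ} (hl : 0 ≤ lam) (hα : 0 < α) (hs : 0 < s) :
    laplaceI₂ lam ρ α s ≤ 1 := by
  rw [laplaceI₂, ← laplaceRange, Real.exp_le_one_iff, neg_nonpos]
  have := laplace_exponent_nonneg (ρ := ρ) hα hs
  have := Real.pi_pos
  positivity

/-- A version of `laplaceI₂` on the extended half-line that is measurable by construction. -/
def laplaceENN (lam ρ α s : ℝ) : ℝ≥0∞ :=
  expNeg (ENNReal.ofReal (2 * Real.pi * lam) * ∫⁻ r in Set.Ioi (0 : ℝ), (Set.Ici ρ).indicator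
      (fun r => ENNReal.ofReal (r * (s * r ^ (-α) / (1 + s * r ^ (-α))))) r)

lemma measurable_laplaceENN (lam ρ α : ℝ) : Measurable (laplaceENN lam ρ α) := by
  refine measurable_expNeg.comp (measurable_const.mul ?_)
  refine Measurable.lintegral_prod_right' (f := fun z : ℝ × ℝ => (Set.Ici ρ).indicator
      (fun r => ENNReal.ofReal (r * (z.1 * r ^ (-α) / (1 + z.1 * r ^ (-α))))) z.2) ?_
  refine Measurable.ite (measurable_snd measurableSet_Ici) ?_ measurable_const
  fun_prop

lemma laplaceENN_eq {lam ρ α s : ℝ} (hl : 0 ≤ lam) (hρ : 0 ≤ ρ) (hα : 2 < α) (hs : 0 < s) :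
    laplaceENN lam ρ α s = ENNReal.ofReal (laplaceI₂ lam ρ α s) := by
  have := laplace_exponent_nonneg (ρ := ρ) (two_pos.trans hα) hs
  rw [laplaceENN, lintegral_radial_eq_laplace hρ hα hs, ← ENNReal.ofReal_mul (by positivity),
    expNeg_ofReal (by positivity), laplaceI₂, ← laplaceRange]

/-- For `r > ρ` the range of integration contains `(0, β]`. There the integrand is at least its
value `r ^ 2 / (α * (1 + β))` at `z = β`, so the exponent grows like `r ^ 2`. -/
lemma laplaceI₂_le_exp {lam ρ α β r : ℝ} (hl : 0 ≤ lam) (hρ : 0 ≤ ρ) (hα : 2 < α) (hβ : 0 < β)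
    (hr : ρ < r) :
    laplaceI₂ lam ρ α (β * r ^ α) ≤
      Real.exp (-(2 * Real.pi * lam * (β / (α * (1 + β)))) * r ^ 2) := by
  have hα0 : 0 < α := two_pos.trans hα
  have hr0 : 0 < r := hρ.trans_lt hr
  have hs : 0 < β * r ^ α := by positivity
  set s := β * r ^ α with hsd
  have hsub : Set.Ioc 0 β ⊆ laplaceRange ρ α s := by
    intro z hz
    refine ⟨hz.1, (ENNReal.ofReal_le_ofReal hz.2).trans ?_⟩
    -- The point `s * r ^ (-α)` equals `β`.
    have := ((mem_laplaceRange hρ hα0 hs hr0).2 hr.le).2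
    rwa [hsd, mul_assoc, ← Real.rpow_add hr0, add_neg_cancel, Real.rpow_zero, mul_one] at this
  have hint : IntegrableOn (fun z => s ^ (2 / α) / (α * (1 + z) * z ^ (2 / α)))
      (laplaceRange ρ α s) :=
    (integrableOn_laplace_integrand hα).mono_set fun z hz => hz.1
  have hs2 : s ^ (2 / α) = β ^ (2 / α) * r ^ 2 := by
    rw [hsd, Real.mul_rpow hβ.le (by positivity), ← Real.rpow_mul hr0.le,
      mul_div_cancel₀ _ hα0.ne', Real.rpow_two]
  have hlow : β / (α * (1 + β)) * r ^ 2 ≤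
      ∫ z in laplaceRange ρ α s, s ^ (2 / α) / (α * (1 + z) * z ^ (2 / α)) := by
    calc β / (α * (1 + β)) * r ^ 2
        = ∫ z in Set.Ioc 0 β, r ^ 2 / (α * (1 + β)) := by
          rw [setIntegral_const, Measure.real, Real.volume_Ioc, sub_zero,
            ENNReal.toReal_ofReal hβ.le, smul_eq_mul]
          ring
      _ ≤ ∫ z in Set.Ioc 0 β, s ^ (2 / α) / (α * (1 + z) * z ^ (2 / α)) := by
          refine setIntegral_mono_on (by simp) (hint.mono_set hsub) measurableSet_Ioc
            fun z hz => ?_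
          have hz0 : 0 < z := hz.1
          have h1 : z ^ (2 / α) ≤ β ^ (2 / α) := Real.rpow_le_rpow hz0.le hz.2 (by positivity)
          rw [hs2, div_le_div_iff₀ (by positivity) (by positivity)]
          have h2 : (1 + z) * z ^ (2 / α) ≤ (1 + β) * β ^ (2 / α) :=
            mul_le_mul (by linarith [hz.2]) h1 (by positivity) (by positivity)
          calc r ^ 2 * (α * (1 + z) * z ^ (2 / α))
              = r ^ 2 * α * ((1 + z) * z ^ (2 / α)) := by ring
            _ ≤ r ^ 2 * α * ((1 + β) * β ^ (2 / α)) := by gcongr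
            _ = β ^ (2 / α) * r ^ 2 * (α * (1 + β)) := by ring
      _ ≤ _ := setIntegral_mono_set hint ((ae_restrict_iff' (measurableSet_laplaceRange _ _ _)).2
          (ae_of_all _ fun z hz => by
            have := hz.1
            simp only [Pi.zero_apply]
            positivity)) hsub.eventuallyLE
  rw [laplaceI₂, ← laplaceRange, Real.exp_le_exp, neg_mul, neg_le_neg_iff, mul_assoc _ (β / _)]
  have := Real.pi_pos
  gcongr

lemma integrableOn_laplaceI₂_mul {lam ρ α β : ℝ} (hl : 0 < lam) (hρ : 0 ≤ ρ) (hα : 2 < α)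
    (hβ : 0 < β) :
    IntegrableOn (fun r : ℝ => laplaceI₂ lam ρ α (β * r ^ α) * r) (Set.Ioi ρ) := by
  have hα0 : 0 < α := two_pos.trans hα
  have hb : 0 < 2 * Real.pi * lam * (β / (α * (1 + β))) := by
    have := Real.pi_pos
    positivity
  refine Integrable.mono' (integrable_mul_exp_neg_mul_sq hb).integrableOn ?_ ?_
  · refine AEStronglyMeasurable.congr (f := fun r => (laplaceENN lam ρ α (β * r ^ α)).toReal * r)
      ?_ ((ae_restrict_iff' measurableSet_Ioi).2 (ae_of_all _ fun r hr => ?_))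
    · exact ((((measurable_laplaceENN lam ρ α).comp
        (measurable_const.mul (measurable_id.pow_const α))).ennreal_toReal).mul
          measurable_id).aestronglyMeasurable
    · have hr0 : 0 < r := hρ.trans_lt hr
      simp only
      rw [laplaceENN_eq hl.le hρ hα (by positivity),
        ENNReal.toReal_ofReal (laplaceI₂_pos _ _ _ _).le]
  · refine (ae_restrict_iff' measurableSet_Ioi).2 (ae_of_all _ fun r hr => ?_)
    have hr0 : 0 < r := hρ.trans_lt hr
    rw [Real.norm_of_nonneg (mul_nonneg (laplaceI₂_pos _ _ _ _).le hr0.le), mul_comm]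
    exact mul_le_mul_of_nonneg_left (laplaceI₂_le_exp hl.le hρ hα hβ hr) hr0.le

/-! ### The secure communication probability -/

open Classical in
/-- The probability that an ER at `y` neither lies in the guard zone nor decodes the signal. -/
def secure (p : Params) (lam β : ℝ) (y : Plane) : ℝ≥0∞ :=
  if y ≠ p.x₁ ∧ y ∉ Metric.ball p.x₁ p.rg then
    1 - ENNReal.ofReal (laplaceI₂ lam p.rg p.alpha (β * dist p.x₁ y ^ p.alpha)) else 0

open Classical in
/-- The indicator of the event that an ER at `y` in state `w` neither lies in the guard zone nor
decodes the signal. -/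
def secureIndicator (p : Params) (β : ℝ) (y : Plane) (w : State) : ℝ≥0∞ :=
  if (y ≠ p.x₁ ∧ y ∉ Metric.ball p.x₁ p.rg) ∧ sir p p.rg y w ≤ ENNReal.ofReal β then 1 else 0

lemma secureIndicator_le_one (p : Params) (β : ℝ) (y : Plane) (w : State) :
    secureIndicator p β y w ≤ 1 := by
  rw [secureIndicator]
  split_ifs <;> simp

lemma measurable_secureIndicator (p : Params) (β : ℝ) :
    Measurable (Function.uncurry (secureIndicator p β)) := by
  refine Measurable.ite ?_ measurable_const measurable_const
  exact ((measurable_fst (measurableSet_singleton p.x₁).compl).inter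
    (measurable_fst Metric.isOpen_ball.measurableSet.compl)).inter
    (measurableSet_le (measurable_sir p p.rg) measurable_const)

/-- Almost everywhere `1 - secure` is `1` on the guard disc and the Laplace transform outside it.
The disc gives the first term and polar coordinates around `x₁` the second. -/
lemma lintegral_one_sub_secure (p : Params) {lam β : ℝ} (hl : 0 < lam) (hβ : 0 < β) :
    ∫⁻ y, (1 - secure p lam β y) ∂(ENNReal.ofReal p.lamS • (volume : Measure Plane)) =
      ENNReal.ofReal (p.lamS * Real.pi * p.rg ^ 2 + 2 * Real.pi * p.lamS *
        ∫ r in Set.Ioi p.rg, laplaceI₂ lam p.rg p.alpha (β * r ^ p.alpha) * r) := by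
  have hS := p.lamS_pos
  have hα := p.two_lt_alpha
  have hπ := Real.pi_pos
  set φ : ℝ → ℝ≥0∞ := (Set.Ici p.rg).indicator
    fun r => laplaceENN lam p.rg p.alpha (β * r ^ p.alpha) with hφd
  have hφ : Measurable φ := ((measurable_laplaceENN lam p.rg p.alpha).comp
    (measurable_const.mul (measurable_id.pow_const _))).indicator measurableSet_Ici
  have h0 : ∀ᵐ y : Plane, y ≠ p.x₁ := by simp [ae_iff]
  have h1 : ∀ᵐ y : Plane, 1 - secure p lam β y =
      (Metric.ball p.x₁ p.rg).indicator 1 y + φ ‖y - p.x₁‖ := by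
    filter_upwards [h0] with y hy
    have hd : 0 < dist p.x₁ y := dist_pos.2 hy.symm
    rw [← dist_eq_norm, dist_comm y]
    by_cases h : y ∈ Metric.ball p.x₁ p.rg
    · rw [secure, if_neg fun h' => h'.2 h, Set.indicator_of_mem h, hφd,
        Set.indicator_of_notMem (by simpa using Metric.mem_ball'.1 h)]
      simp
    · rw [secure, if_pos ⟨hy, h⟩, Set.indicator_of_notMem h, hφd, Set.indicator_of_mem
        (by simpa [dist_comm] using h), zero_add,
        laplaceENN_eq hl.le p.rg_nonneg hα (by positivity), ENNReal.sub_sub_cancel ENNReal.one_ne_top]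
      exact ENNReal.ofReal_le_one.2 (laplaceI₂_le_one hl.le (two_pos.trans hα) (by positivity))
  have hI := integrableOn_laplaceI₂_mul hl p.rg_nonneg hα hβ
  have hres : (volume.restrict (Set.Ioi (0 : ℝ))).restrict (Set.Ioi p.rg) =
      volume.restrict (Set.Ioi p.rg) := by
    rw [Measure.restrict_restrict measurableSet_Ioi,
      Set.inter_eq_left.2 (Set.Ioi_subset_Ioi p.rg_nonneg)]
  have h2 : ∫⁻ r in Set.Ioi (0 : ℝ), ENNReal.ofReal r * φ r =
      ENNReal.ofReal (∫ r in Set.Ioi p.rg, laplaceI₂ lam p.rg p.alpha (β * r ^ p.alpha) * r) := by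
    rw [ofReal_integral_eq_lintegral_ofReal hI ((ae_restrict_iff' measurableSet_Ioi).2
      (ae_of_all _ fun r hr => mul_nonneg (laplaceI₂_pos _ _ _ _).le (p.rg_nonneg.trans (le_of_lt hr)))),
      ← hres, ← lintegral_indicator (s := Set.Ioi p.rg) measurableSet_Ioi]
    -- `φ` lives on the closed half-line and the target integral on the open one; the endpoint is
    -- null.
    have hne : ∀ᵐ r : ℝ, r ≠ p.rg := by simp [ae_iff]
    refine lintegral_congr_ae ((ae_restrict_iff' measurableSet_Ioi).2 (hne.mono fun r hr hr0 => ?_))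
    have hr0 : 0 < r := hr0
    change ENNReal.ofReal r * φ r = _
    rcases lt_or_gt_of_ne hr with h | h
    · rw [hφd, Set.indicator_of_notMem (show r ∉ Set.Ici p.rg from not_le.2 h), Set.indicator_of_notMem
        (show r ∉ Set.Ioi p.rg from h.not_gt), mul_zero]
    · rw [hφd, Set.indicator_of_mem (Set.mem_Ici.2 h.le), Set.indicator_of_mem (Set.mem_Ioi.2 h),
        laplaceENN_eq hl.le p.rg_nonneg hα (by positivity), mul_comm,
        ENNReal.ofReal_mul (laplaceI₂_pos _ _ _ _).le]
  have hI0 : 0 ≤ ∫ r in Set.Ioi p.rg, laplaceI₂ lam p.rg p.alpha (β * r ^ p.alpha) * r :=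
    setIntegral_nonneg measurableSet_Ioi fun r hr =>
      mul_nonneg (laplaceI₂_pos _ _ _ _).le (p.rg_nonneg.trans (le_of_lt hr))
  rw [lintegral_smul_measure, lintegral_congr_ae h1, lintegral_add_left
    (measurable_one.indicator Metric.isOpen_ball.measurableSet), smul_add,
    lintegral_indicator_one Metric.isOpen_ball.measurableSet, ← Measure.smul_apply,
    smul_volume_ball hS.le p.rg_nonneg,
    lintegral_sub_right_eq_self (fun y => φ ‖y‖) p.x₁, lintegral_fun_norm hφ, h2, smul_eq_mul,
    ← ENNReal.ofReal_mul (by positivity), ← ENNReal.ofReal_mul hS.le,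
    ← ENNReal.ofReal_add (by positivity) (by positivity)]
  congr 2
  ring

namespace Network

variable {Ω : Type*} [MeasurableSpace Ω] {N : Network Ω} {p : Params} {μ : Measure Ω}

lemma IsModel.indep_receivers (hN : N.IsModel p μ) (n : ℕ) :
    Indep (N.infoOf {.er} ⊔ ⨆ i ∈ Finset.range n, N.infoOf (receiverSources (some i)))
      (N.infoOf (receiverSources (some n))) μ := by
  refine indep_of_indep_of_le_left (hN.indep_infoOf
    (S := {.er} ∪ ⋃ i ∈ Finset.range n, receiverSources (some i)) ?_) ?_
  · rw [Set.disjoint_left]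
    rintro s hs hs'
    simp only [receiverSources, interfererSources, Set.mem_union, Set.mem_singleton_iff,
      Set.mem_iUnion, Finset.mem_range, Set.mem_ofPred_eq, exists_prop] at hs hs'
    rcases hs' with rfl | rfl | ⟨i, rfl | rfl⟩ <;> simp at hs
  · exact sup_le (biSup_mono fun s hs => Or.inl hs) (iSup₂_le fun i hi =>
      biSup_mono fun s hs => Or.inr (Set.mem_biUnion hi hs))

lemma IsModel.lintegral_secure [IsProbabilityMeasure μ] (hN : N.IsModel p μ) {β : ℝ} (hβ : 0 < β)
    (j : ℕ) (y : Plane) :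
    ∫⁻ ω, secureIndicator p β y (N.state (some j) ω) ∂μ = secure p (p.lamP * N.pActive p μ) β y := by
  by_cases h : y ≠ p.x₁ ∧ y ∉ Metric.ball p.x₁ p.rg
  · set B : Set Ω := {ω | ENNReal.ofReal β < sir p p.rg y (N.state (some j) ω)} with hB
    have hBm : MeasurableSet B := measurableSet_lt measurable_const
      (((measurable_sir p p.rg).comp measurable_prodMk_left).comp
        ((N.measurable_state (some j)).mono (hN.infoOf_le _) le_rfl))
    rw [secure, if_pos h, ← hN.measure_lt_sir (some j) h.1 p.rg_nonneg hβ, ← hB,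
      ← prob_compl_eq_one_sub hBm, ← lintegral_indicator_one hBm.compl]
    refine lintegral_congr fun ω => ?_
    simp [secureIndicator, h, hB, Set.indicator]
  · rw [secure, if_neg h]
    simp [secureIndicator, -Metric.mem_ball, h]

-- The guard event is a condition on each ER separately, so the joint event is a product of
-- indicators over the ERs and one application of the marked generating functional suffices.
open Classical in
theorem IsModel.measure_clear_inter_secure [IsProbabilityMeasure μ] (hN : N.IsModel p μ)
    (hER : p.noiseER = 0) {β : ℝ} (hβ : 0 < β) (hP : 0 < N.pActive p μ) :
    μ (N.clear p ∩ {ω | ∀ j, N.sinr p (some j) ω ≤ ENNReal.ofReal β}) =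
      ENNReal.ofReal (Real.exp (-(p.lamS * Real.pi * p.rg ^ 2 + 2 * Real.pi * p.lamS *
        ∫ r in Set.Ioi p.rg, laplaceI₂ (p.lamP * N.pActive p μ) p.rg p.alpha
          (β * r ^ p.alpha) * r))) := by
  have hσ := sigmaFinite_ofReal_smul_volume p.lamS
  have hl : 0 < p.lamP * N.pActive p μ := mul_pos p.lamP_pos hP
  have hX : ∀ j, Measurable[N.infoOf {.er}] (N.er j) := N.measurable_er (Set.mem_singleton _)
  have hW : ∀ j, Measurable[N.infoOf (receiverSources (some j))] (N.state (some j)) :=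
    fun j => N.measurable_state (some j)
  have hW' : ∀ j, Measurable (N.state (some j)) := fun j => (hW j).mono (hN.infoOf_le _) le_rfl
  have hX' := hN.er_poisson.measurable
  have hZ : ∀ ω, Tendsto
      (fun n => ∏ i ∈ Finset.range n, secureIndicator p β (N.er i ω) (N.state (some i) ω)) atTop
      (𝓝 (if ∀ j, (N.er j ω ≠ p.x₁ ∧ N.er j ω ∉ Metric.ball p.x₁ p.rg) ∧
        sir p p.rg (N.er j ω) (N.state (some j) ω) ≤ ENNReal.ofReal β then 1 else 0)) :=
    fun ω => tendsto_prod_ite _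
  have key := IsPoissonProcess.lintegral_marked (E := Plane) (S := State) (m := N.infoOf {.er})
    (m' := fun j => N.infoOf (receiverSources (some j))) (X := N.er)
    (W := fun j => N.state (some j)) (f := secureIndicator p β)
    (q := secure p (p.lamP * N.pActive p μ) β)
    (ν := ENNReal.ofReal p.lamS • (volume : Measure Plane)) hN.er_poisson
    (hN.infoOf_le _) (fun j => hN.infoOf_le _) hN.indep_receivers hX hW
    (measurable_secureIndicator p β) (secureIndicator_le_one p β)
    (hN.lintegral_secure hβ) hZ
  have hI : 0 ≤ ∫ r in Set.Ioi p.rg, laplaceI₂ (p.lamP * N.pActive p μ) p.rg p.alpha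
      (β * r ^ p.alpha) * r :=
    setIntegral_nonneg measurableSet_Ioi fun r hr =>
      mul_nonneg (laplaceI₂_pos _ _ _ _).le (p.rg_nonneg.trans (le_of_lt hr))
  have hS := p.lamS_pos
  have hπ := Real.pi_pos
  rw [lintegral_one_sub_secure p hl hβ, expNeg_ofReal (by positivity)] at key
  rw [← key]
  set A : Set Ω := {ω | ∀ j, (N.er j ω ≠ p.x₁ ∧ N.er j ω ∉ Metric.ball p.x₁ p.rg) ∧
    sir p p.rg (N.er j ω) (N.state (some j) ω) ≤ ENNReal.ofReal β} with hA
  have hAm : MeasurableSet A := by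
    rw [hA, Set.ofPred_forall]
    refine MeasurableSet.iInter fun j => ?_
    exact ((hX' j (measurableSet_singleton p.x₁).compl).inter
      (hX' j Metric.isOpen_ball.measurableSet.compl)).inter
      (measurableSet_le ((measurable_sir p p.rg).comp ((hX' j).prodMk (hW' j))) measurable_const)
  -- If `rg = 0` the guard disc is empty and does not exclude an ER at `x₁`; that event is null as
  -- `{x₁}` has measure zero.
  have hne : ∀ᵐ ω ∂μ, ∀ j, N.er j ω ∉ ({p.x₁} : Set Plane) := by
    have hm : MeasurableSet {ω | ∀ j, N.er j ω ∉ ({p.x₁} : Set Plane)} := by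
      rw [Set.ofPred_forall]
      exact MeasurableSet.iInter fun j => hX' j (measurableSet_singleton p.x₁).compl
    refine (prob_compl_eq_zero_iff hm).2 ?_
    rw [hN.er_poisson.measure_forall_notMem (measurableSet_singleton p.x₁)]
    simp
  have hAE : (N.clear p ∩ {ω | ∀ j, N.sinr p (some j) ω ≤ ENNReal.ofReal β} : Set Ω) =ᵐ[μ] A := by
    filter_upwards [hne] with ω hω
    refine propext ?_
    change (ω ∈ N.clear p ∧ ∀ j, N.sinr p (some j) ω ≤ ENNReal.ofReal β) ↔ _
    rw [clear_eq]
    simp only [sinr_eq_sir_some hER]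
    exact ⟨fun h j => ⟨⟨hω j, h.1 j⟩, h.2 j⟩, fun h => ⟨fun j => (h j).1.2, fun j => (h j).2⟩⟩
  rw [measure_congr hAE, ← lintegral_indicator_one hAm]
  refine lintegral_congr fun ω => ?_
  simp [Set.indicator, hA]

theorem IsModel.pSec_eq [IsProbabilityMeasure μ] (hN : N.IsModel p μ) (hER : p.noiseER = 0)
    {β : ℝ} (hβ : 0 < β) (hP : 0 < N.pActive p μ) :
    N.pSec p μ β = Real.exp (-(2 * Real.pi * p.lamS *
        ∫ r in Set.Ioi p.rg,
          laplaceI₂ (p.lamP * N.pActive p μ) p.rg p.alpha (β * r ^ p.alpha) * r)) := by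
  have hm : MeasurableSet (N.clear p) := hN.infoOf_le _ _ (N.measurableSet_clear p)
  rw [pSec, measureReal_def, cond_apply hm, hN.measure_clear_inter_secure hER hβ hP,
    hN.measure_clear, ← ENNReal.ofReal_inv_of_pos (Real.exp_pos _), ← Real.exp_neg,
    ← ENNReal.ofReal_mul (Real.exp_pos _).le, ENNReal.toReal_ofReal (by positivity),
    ← Real.exp_add]
  congr 1
  ring

end Network

end GuardZone

end

theorem mainTheorem7 {Ω : Type*} [MeasurableSpace Ω] (μ : Measure Ω) [IsProbabilityMeasure μ]
    (p : GuardZone.Params) (N : GuardZone.Network Ω) (hN : N.IsModel p μ)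
    (hPR : p.noisePR = 0) (hER : p.noiseER = 0)
    (βP βS : ℝ) (hβP : 0 < βP) (hβS : 0 < βS) :
    N.pActive p μ = Real.exp (-(p.lamS * Real.pi * p.rg ^ 2)) ∧
    N.pCon p μ βP =
      Real.exp (-(p.lamS * Real.pi * p.rg ^ 2 +
        2 * Real.pi ^ 2 * p.lamP * N.pActive p μ * βP ^ (2 / p.alpha) * p.r₁ ^ 2 /
          (p.alpha * Real.sin (2 * Real.pi / p.alpha)))) ∧
    IntegrableOn (fun r : ℝ =>
      GuardZone.laplaceI₂ (p.lamP * N.pActive p μ) p.rg p.alpha (βS * r ^ p.alpha) * r)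
      (Set.Ioi p.rg) ∧
    N.pSec p μ βS =
      Real.exp (-(2 * Real.pi * p.lamS *
        ∫ r in Set.Ioi p.rg,
          GuardZone.laplaceI₂ (p.lamP * N.pActive p μ) p.rg p.alpha (βS * r ^ p.alpha) * r)) := by
  have hP : 0 < N.pActive p μ := by
    rw [hN.pActive_eq]
    exact Real.exp_pos _
  exact ⟨hN.pActive_eq, hN.pCon_eq hPR hβP,
    GuardZone.integrableOn_laplaceI₂_mul (mul_pos p.lamP_pos hP) p.rg_nonneg p.two_lt_alpha hβS,
    hN.pSec_eq hER hβS hP⟩
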